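/- **Theorem 3.12 (Mani–Walkup).** A triangulated $d$-sphere is a finite simplicial complex $K$ whose geometric realization is homeomorphic to $S^d$. Its facets are its maximal faces; its ridge-graph has the facets as nodes, two facets being adjacent when their intersection is a ridge (has codimension one in both). $K$ has the non-revisiting property if any two facets are joined by a path in the ridge-graph which at every step enters a vertex of $K$ that did not lie in any facet visited before. Wedging (one-point suspension) of $K$ at a vertex $v$, with a new vertex $w$, produces the complex $$\big((K\setminus v) * \{v,w\}\big)\ \cup\ \big(\operatorname{lk}_K(v) * \overline{vw}\big),$$ where $K\setminus v$ is the subcomplex of faces not containing $v$, $\{v,w\}$ denotes the complex consisting of two points, and $\overline{vw}$ the segment with its two endpoints. There is a triangulated $3$-sphere $K$ with $16$ vertices that does not have the non-revisiting property, and from which a suitable sequence of eight successive wedgings produces a triangulated $11$-sphere with $24$ vertices whose ridge-graph is connected and has diameter at least $13$. In particular the topological Hirsch conjecture, which asserts that for all $n$ and $d\ge 1$ the ridge-graph of every triangulated $(d-1)$-sphere with $n$ vertices has diameter at most $n-d$, is false. -/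

import Mathlib

namespace PreAbstractSimplicialComplex

variable {V : Type*}

/-- The set of vertices of a simplicial complex. -/
def vertexSet (K : PreAbstractSimplicialComplex V) : Set V :=
  {v | {v} ∈ K.faces}

/-- The geometric realization of a complex in barycentric coordinates, a subspace of `V → ℝ`: the
union over the faces `s` of the standard simplices spanned by `s`. It is used only for finite
complexes, for which the product topology gives the usual topology of the realization. -/
def realization (K : PreAbstractSimplicialComplex V) : Set (V → ℝ) :=
  {x | (∀ v, 0 ≤ x v) ∧ ∃ s ∈ K.faces, (∀ v, v ∉ s → x v = 0) ∧ ∑ v ∈ s, x v = 1}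

/-- `K` is a triangulated `d`-sphere: a finite simplicial complex whose geometric realization is
homeomorphic to the unit sphere of `ℝ^(d+1)`. -/
def IsTriangulatedSphere (K : PreAbstractSimplicialComplex V) (d : ℕ) : Prop :=
  K.faces.Finite ∧
    Nonempty (K.realization ≃ₜ Metric.sphere (0 : EuclideanSpace ℝ (Fin (d + 1))) 1)

/-- The facets of a simplicial complex are its inclusion-maximal faces. -/
def IsFacet (K : PreAbstractSimplicialComplex V) (s : Finset V) : Prop :=
  Maximal (fun t => t ∈ K.faces) s

variable [DecidableEq V]

/-- The ridge-graph (dual graph): its nodes are the facets, and two facets are adjacent when their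
intersection is a ridge, that is, has codimension one in both of them. -/
def ridgeGraph (K : PreAbstractSimplicialComplex V) : SimpleGraph {s : Finset V // K.IsFacet s} where
  Adj F G := (F.1 ∩ G.1).card + 1 = F.1.card ∧ (F.1 ∩ G.1).card + 1 = G.1.card
  symm := ⟨fun F G h => by
    rw [Finset.inter_comm G.1 F.1]
    exact ⟨h.2, h.1⟩⟩
  loopless := ⟨fun F h => by
    have := h.1
    simp at this⟩

/-- A walk in the ridge-graph is non-revisiting if whatever vertex of the complex is entered at a
step (from the `i`-th to the `(i+1)`-st facet of the walk) does not lie in any of the facets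
visited before. -/
def IsNonRevisiting {K : PreAbstractSimplicialComplex V} {F G : {s : Finset V // K.IsFacet s}}
    (p : K.ridgeGraph.Walk F G) : Prop :=
  ∀ i < p.length, ∀ x ∈ (p.getVert (i + 1)).1, x ∉ (p.getVert i).1 →
    ∀ j ≤ i, x ∉ (p.getVert j).1

/-- The non-revisiting property: any two facets are joined by a non-revisiting path. -/
def HasNonRevisitingProperty (K : PreAbstractSimplicialComplex V) : Prop :=
  ∀ F G : {s : Finset V // K.IsFacet s}, ∃ p : K.ridgeGraph.Walk F G, IsNonRevisiting p

/-- The one-point suspension of `K` at the vertex `v`, the vertex `v` itself and the new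
vertex `w` being its two copies of `v`. It is the union of the join of the deletion of `v` in `K`
with the two points `v`, `w`, and of the join of the link of `v` in `K` with the segment `{v, w}`.
It is meant for a vertex `v` of `K` and a `w` that is not a vertex of `K`. -/
def onePointSuspension (K : PreAbstractSimplicialComplex V) (v w : V) :
    PreAbstractSimplicialComplex V where
  faces := {s | s.Nonempty ∧ (s \ {v, w} = ∅ ∨ s \ {v, w} ∈ K.faces) ∧
    (v ∈ s → w ∈ s → insert v (s \ {v, w}) ∈ K.faces)}
  isRelLowerSet_faces := by
    rintro s ⟨hs, h1, h2⟩
    refine ⟨hs, fun t hts ht => ?_⟩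
    have hsub : t \ {v, w} ⊆ s \ {v, w} := Finset.sdiff_subset_sdiff hts (Finset.Subset.refl _)
    refine ⟨ht, ?_, fun hv hw => ?_⟩
    · rcases (t \ {v, w}).eq_empty_or_nonempty with h | h
      · exact Or.inl h
      · rcases h1 with h1 | h1
        · rw [h1] at hsub
          exact Or.inl (Finset.subset_empty.1 hsub)
        · exact Or.inr ((K.isRelLowerSet_faces h1).2 hsub h)
    · exact (K.isRelLowerSet_faces (h2 (hts hv) (hts hw))).2
        (Finset.insert_subset_insert v hsub) (Finset.insert_nonempty v _)

/-- `L` is obtained from `K` by wedging: it is the one-point suspension of `K` at one of its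
vertices. -/
def IsWedgeOf (L K : PreAbstractSimplicialComplex V) : Prop :=
  ∃ v ∈ K.vertexSet, ∃ w ∉ K.vertexSet, L = K.onePointSuspension v w

end PreAbstractSimplicialComplex

/-- The topological Hirsch conjecture: the ridge-graph of every triangulated `(d-1)`-sphere with `n`
vertices has diameter at most `n - d`. (Here `d = e + 1`; the ridge-graph of a triangulated
sphere is finite and connected, so that `SimpleGraph.diam` is its diameter.) -/
def TopologicalHirschConjecture : Prop :=
  ∀ (V : Type) [DecidableEq V] (K : PreAbstractSimplicialComplex V) (e : ℕ),
    K.IsTriangulatedSphere e → K.ridgeGraph.diam + (e + 1) ≤ K.vertexSet.ncard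

/-! Two disjoint facets A = {0,1,2,3} and B = {4,5,6,7} of a 16-vertex 3-sphere are not joined by
any non-revisiting path; an exhaustive search (`noPath_sphereFacets`) shows this. Wedging at a
vertex v outside A ∪ B, with new vertex w, replaces A by A ∪ {v} and B by B ∪ {w}. Collapsing facets
of the wedge back to facets of the original complex turns a sequence in which each vertex occupies
an interval of times into another such sequence, possibly with pauses
(`HasConvexSequence.of_onePointSuspension`). So the absence of such sequences survives wedging.

After wedging at each of the eight vertices 8, …, 15, the two facets have 12 vertices each and
partition the 24 vertices. A path of length at most 12 between complementary 12-element facets has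
to trade a vertex of A for a vertex of B at every step, hence never revisits
(`convex_of_length_le`). No such path exists, so the distance is at least 13 > 24 - 12.

That the complexes are spheres is proved on the cone of nonnegative vectors supported on faces: a
positively homogeneous homeomorphism of this cone with ℝⁿ restricts, after radial normalization, to
a homeomorphism of the realization with a sphere. On cones everything is an explicit piecewise
linear map built from minima: wedging multiplies the cone by a line
(`coneEquiv_onePointSuspension`), a bistellar flip preserves it (`coneEquiv_of_flip`), and the
boundary of a simplex gives ℝⁿ (`coneEquiv_of_simplex_boundary`). A list of flips, checked by
computation, connects the boundary of a 4-simplex to the 3-sphere. -/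

/-- A positively homogeneous homeomorphism between two subsets of real topological modules. -/
def ConeEquiv {X Y : Type*} [TopologicalSpace X] [SMul ℝ X] [TopologicalSpace Y] [SMul ℝ Y]
    (S : Set X) (T : Set Y) : Prop :=
  ∃ (f : X → Y) (g : Y → X), ContinuousOn f S ∧ ContinuousOn g T ∧ Set.MapsTo f S T ∧
    Set.MapsTo g T S ∧ Set.LeftInvOn g f S ∧ Set.LeftInvOn f g T ∧
    ∀ c : ℝ, 0 ≤ c → ∀ x ∈ S, f (c • x) = c • f x

namespace ConeEquiv

variable {X Y Z : Type*} [TopologicalSpace X] [SMul ℝ X] [TopologicalSpace Y] [SMul ℝ Y]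
  [TopologicalSpace Z] [SMul ℝ Z] {S : Set X} {T : Set Y} {U : Set Z}

theorem trans (h : ConeEquiv S T) (h' : ConeEquiv T U) : ConeEquiv S U := by
  obtain ⟨f, g, hf, hg, mf, mg, gf, fg, hom⟩ := h
  obtain ⟨f', g', hf', hg', mf', mg', gf', fg', hom'⟩ := h'
  refine ⟨f' ∘ f, g ∘ g', hf'.comp hf mf, hg.comp hg' mg', mf'.comp mf, mg.comp mg', ?_, ?_, ?_⟩
  · intro x hx
    simp [gf' (mf hx), gf hx]
  · intro x hx
    simp [fg (mg' hx), fg' hx]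
  · intro c hc x hx
    simp [hom c hc x hx, hom' c hc _ (mf hx)]

theorem symm (h : ConeEquiv S T) (hS : ∀ c : ℝ, 0 ≤ c → ∀ x ∈ S, c • x ∈ S) : ConeEquiv T S := by
  obtain ⟨f, g, hf, hg, mf, mg, gf, fg, hom⟩ := h
  refine ⟨g, f, hg, hf, mg, mf, fg, gf, fun c hc y hy => ?_⟩
  rw [← gf (hS c hc _ (mg hy)), hom c hc _ (mg hy), fg hy]

end ConeEquiv

/-! ### Cones over complexes and their realizations -/

namespace PreAbstractSimplicialComplex

/-- The cone of nonnegative vectors supported on a face. -/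
def cone {V : Type*} (K : PreAbstractSimplicialComplex V) : Set (V → ℝ) :=
  {x | (∀ v, 0 ≤ x v) ∧ ∃ s ∈ K.faces, ∀ v, v ∉ s → x v = 0}

section

variable {V : Type*} {K : PreAbstractSimplicialComplex V}

theorem smul_mem_cone {c : ℝ} (hc : 0 ≤ c) {x : V → ℝ} (hx : x ∈ K.cone) : c • x ∈ K.cone := by
  obtain ⟨h0, s, hs, h⟩ := hx
  refine ⟨fun v => mul_nonneg hc (h0 v), s, hs, fun v hv => ?_⟩
  simp [h v hv]

/-- The realization is the slice of the cone with coordinate sum 1, the sphere the slice of norm 1.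
Homogeneity makes rescaling to one slice undo rescaling to the other. -/
theorem isTriangulatedSphere_of_coneEquiv (hK : K.faces.Finite) {d : ℕ}
    (h : ConeEquiv K.cone (Set.univ : Set (Fin (d + 1) → ℝ))) : K.IsTriangulatedSphere d := by
  classical
  refine ⟨hK, ?_⟩
  have h' : ConeEquiv K.cone (Set.univ : Set (EuclideanSpace ℝ (Fin (d + 1)))) := by
    refine h.trans ⟨fun x => WithLp.toLp 2 x, fun x => x.ofLp, by fun_prop, by fun_prop,
      fun _ _ => trivial, fun _ _ => trivial, fun _ _ => rfl, fun _ _ => rfl, fun _ _ _ _ => rfl⟩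
  obtain ⟨f, g, hf, hg, mf, mg, gf, fg, hom⟩ := h'
  obtain ⟨T, hT⟩ : ∃ T : Finset V, ∀ s ∈ K.faces, s ⊆ T :=
    ⟨hK.toFinset.biUnion id, fun s hs => Finset.subset_biUnion_of_mem id (by simpa using hs)⟩
  have homg : ∀ c : ℝ, 0 ≤ c → ∀ y, g (c • y) = c • g y := by
    intro c hc y
    have hy : g y ∈ K.cone := mg (Set.mem_univ y)
    rw [← gf (smul_mem_cone hc hy), hom c hc _ hy, fg (Set.mem_univ y)]
  let mass : (V → ℝ) → ℝ := fun x => ∑ v ∈ T, x v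
  have mass_cont : Continuous mass := by fun_prop
  have mass_smul : ∀ (c : ℝ) x, mass (c • x) = c * mass x := by
    intro c x
    simp [mass, Finset.mul_sum]
  have mass_face : ∀ s ∈ K.faces, ∀ x : V → ℝ, (∀ v, v ∉ s → x v = 0) →
      ∑ v ∈ s, x v = mass x := by
    intro s hs x hx
    exact Finset.sum_subset (hT s hs) fun v _ hv => hx v hv
  have mem_real : ∀ x, x ∈ K.realization ↔ x ∈ K.cone ∧ mass x = 1 := by
    intro x
    constructor
    · rintro ⟨h0, s, hs, h1, h2⟩
      exact ⟨⟨h0, s, hs, h1⟩, by rw [← mass_face s hs x h1, h2]⟩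
    · rintro ⟨⟨h0, s, hs, h1⟩, h2⟩
      exact ⟨h0, s, hs, h1, by rw [mass_face s hs x h1, h2]⟩
  have mass_zero : ∀ x ∈ K.cone, mass x = 0 → x = 0 := by
    rintro x ⟨h0, s, hs, h1⟩ hx
    ext v
    by_cases hv : v ∈ T
    · exact (Finset.sum_eq_zero_iff_of_nonneg fun v _ => h0 v).1 hx v hv
    · exact h1 v fun h => hv (hT s hs h)
  have mass_nonneg : ∀ x ∈ K.cone, 0 ≤ mass x := fun x hx => Finset.sum_nonneg fun v _ => hx.1 v
  have f_ne : ∀ x ∈ K.realization, f x ≠ 0 := by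
    intro x hx h0
    obtain ⟨hx, h1⟩ := (mem_real x).1 hx
    have : x = 0 := by
      -- Homogeneity with factor 0 says that `g` maps 0 to 0.
      have h2 := homg 0 le_rfl (f x)
      rw [zero_smul, zero_smul] at h2
      rw [← gf hx, h0, h2]
    rw [this] at h1
    simp [mass] at h1
  have g_pos : ∀ y ∈ Metric.sphere (0 : EuclideanSpace ℝ (Fin (d + 1))) 1, 0 < mass (g y) := by
    intro y hy
    refine (mass_nonneg _ (mg (Set.mem_univ y))).lt_of_ne' fun h0 => ?_
    have hgy := mass_zero _ (mg (Set.mem_univ y)) h0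
    have : y = 0 := by
      have h2 := hom 0 le_rfl _ (mg (Set.mem_univ y))
      rw [zero_smul, zero_smul] at h2
      rw [← fg (Set.mem_univ y), hgy, h2]
    rw [this] at hy
    simp at hy
  have hsub : K.realization ⊆ K.cone := fun x hx => ((mem_real x).1 hx).1
  refine ⟨{ toFun := fun x => ⟨‖f x‖⁻¹ • f x, ?_⟩
            invFun := fun y => ⟨(mass (g y))⁻¹ • g y, ?_⟩
            left_inv := ?_
            right_inv := ?_
            continuous_toFun := ?_
            continuous_invFun := ?_ }⟩
  · have := norm_ne_zero_iff.2 (f_ne x x.2)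
    simp [norm_smul, this]
  · have := (g_pos y y.2).ne'
    rw [mem_real]
    refine ⟨smul_mem_cone (inv_nonneg.2 (g_pos y y.2).le) (mg (Set.mem_univ _)), ?_⟩
    rw [mass_smul, inv_mul_cancel₀ this]
  · rintro ⟨x, hx⟩
    have hn := norm_pos_iff.2 (f_ne x hx)
    obtain ⟨hx', h1⟩ := (mem_real x).1 hx
    ext1
    simp only
    rw [homg _ (inv_nonneg.2 hn.le), gf hx', mass_smul, h1, smul_smul]
    field_simp
    simp
  · rintro ⟨y, hy⟩
    have hp := g_pos y hy
    ext1
    simp only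
    rw [hom _ (inv_nonneg.2 hp.le) _ (mg (Set.mem_univ _)), fg (Set.mem_univ _), norm_smul,
      smul_smul, mem_sphere_zero_iff_norm.1 hy, Real.norm_of_nonneg (inv_nonneg.2 hp.le)]
    field_simp
    simp
  · have hc : Continuous fun x : K.realization => f x :=
      continuousOn_iff_continuous_domRestrict.1 (hf.mono hsub)
    exact Continuous.subtype_mk ((hc.norm.inv₀ fun x => norm_ne_zero_iff.2 (f_ne x x.2)).smul hc) _
  · have hc : Continuous fun y : Metric.sphere (0 : EuclideanSpace ℝ (Fin (d + 1))) 1 => g y :=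
      continuousOn_iff_continuous_domRestrict.1 (hg.mono (Set.subset_univ _))
    exact Continuous.subtype_mk
      (((mass_cont.comp hc).inv₀ fun y => (g_pos y y.2).ne').smul hc) _

theorem subset_mem_faces {s t : Finset V} (hs : s ∈ K.faces) (hts : t ⊆ s) (ht : t.Nonempty) :
    t ∈ K.faces :=
  (K.isRelLowerSet_faces hs).2 hts ht

theorem nonempty_of_mem_faces {s : Finset V} (hs : s ∈ K.faces) : s.Nonempty :=
  (K.isRelLowerSet_faces hs).1

theorem singleton_mem_faces {s : Finset V} (hs : s ∈ K.faces) {x : V} (hx : x ∈ s) :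
    {x} ∈ K.faces :=
  subset_mem_faces hs (by simpa using hx) (by simp)

/-- The support of a cone vector lies in a face, so it misses a vertex of any non-face. Minima over
non-faces thus vanish, which is what makes the later maps mutually inverse. -/
theorem inf'_eq_zero_of_mem_cone {σ : Finset V}
    (hσ : σ.Nonempty) (h : ∀ s ∈ K.faces, ¬ σ ⊆ s) {x : V → ℝ} (hx : x ∈ K.cone) :
    σ.inf' hσ x = 0 := by
  obtain ⟨h0, s, hs, hx⟩ := hx
  obtain ⟨u, hu, hus⟩ := Finset.not_subset.1 (h s hs)
  refine le_antisymm ?_ ((Finset.le_inf'_iff hσ _).2 fun u _ => h0 u)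
  rw [← hx u hus]
  exact Finset.inf'_le _ hu

end

/-! ### Wedging multiplies the cone by a line -/

section Wedge

variable {V : Type*} [DecidableEq V] {K : PreAbstractSimplicialComplex V} {v w : V}

/-- The cone over a one-point suspension is the product of the cone over the complex with a line:
the line records the difference of the two coordinates that replace the one at `v`. -/
theorem coneEquiv_onePointSuspension (hv : v ∈ K.vertexSet) (hw : w ∉ K.vertexSet) {n : ℕ}
    (h : ConeEquiv K.cone (Set.univ : Set (Fin n → ℝ))) :
    ConeEquiv (K.onePointSuspension v w).cone (Set.univ : Set (Fin (n + 1) → ℝ)) := by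
  obtain ⟨f, g, hf, hg, mf, mg, gf, fg, hom⟩ := h
  have hvw : v ≠ w := by
    rintro rfl
    exact hw hv
  have hwK : ∀ s ∈ K.faces, w ∉ s := fun s hs hws => hw (singleton_mem_faces hs hws)
  -- The coordinate at `v` becomes the minimum of those at `v` and `w`, and `q` recovers the pair
  -- from this minimum and the difference `t`. The minimum is positive only if the support contains
  -- both copies, and then `v` lies in the underlying face of `K`.
  let p : (V → ℝ) → V → ℝ := fun x u => if u = w then 0 else if u = v then min (x v) (x w) else x u
  let q : (V → ℝ) → ℝ → V → ℝ := fun y t u =>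
    if u = w then y v + max (-t) 0 else if u = v then y v + max t 0 else y u
  have hp : Continuous p := by
    refine continuous_pi fun u => ?_
    simp only [p]
    split_ifs <;> fun_prop
  have hq : Continuous fun z : (V → ℝ) × ℝ => q z.1 z.2 := by
    refine continuous_pi fun u => ?_
    simp only [q]
    split_ifs <;> fun_prop
  have pmem : ∀ x ∈ (K.onePointSuspension v w).cone, p x ∈ K.cone := by
    rintro x ⟨h0, s, ⟨-, h1, h2⟩, hx⟩
    refine ⟨fun u => ?_, ?_⟩
    · simp only [p]
      split_ifs
      exacts [le_rfl, le_min (h0 v) (h0 w), h0 u]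
    by_cases hs : v ∈ s ∧ w ∈ s
    · refine ⟨_, h2 hs.1 hs.2, fun u hu => ?_⟩
      simp only [Finset.mem_insert, Finset.mem_sdiff, Finset.mem_singleton, not_or, not_and,
        not_not] at hu
      simp only [p, if_neg hu.1]
      split_ifs with huw
      · rfl
      · exact hx u fun h => huw (hu.2 h hu.1)
    · have hmin : min (x v) (x w) = 0 := by
        by_cases hvs : v ∈ s
        · rw [hx w fun h => hs ⟨hvs, h⟩]
          exact min_eq_right (h0 v)
        · rw [hx v hvs]
          exact min_eq_left (h0 w)
      have hsupp : ∀ u, u ∉ s \ {v, w} → p x u = 0 := by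
        intro u hu
        simp only [Finset.mem_insert, Finset.mem_sdiff, Finset.mem_singleton, not_and,
          not_not] at hu
        simp only [p, hmin]
        split_ifs with h3 h4
        · rfl
        · rfl
        · exact hx u fun h => (hu h).elim h4 h3
      rcases h1 with h1 | h1
      -- Here `p x` is zero; as the empty set is not a face, `{v}` serves as its supporting face.
      · exact ⟨{v}, hv, fun u _ => hsupp u (by simp [h1])⟩
      · exact ⟨_, h1, hsupp⟩
  have qmem : ∀ y ∈ K.cone, ∀ t, q y t ∈ (K.onePointSuspension v w).cone := by
    rintro y ⟨h0, s, hs, hy⟩ t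
    have hsw := hwK s hs
    refine ⟨fun u => ?_, ?_⟩
    · simp only [q]
      split_ifs
      exacts [add_nonneg (h0 v) (le_max_right _ _), add_nonneg (h0 v) (le_max_right _ _), h0 u]
    by_cases hvs : v ∈ s
    · refine ⟨insert w s, ⟨by simp, ?_, fun _ _ => ?_⟩, fun u hu => ?_⟩
      · rcases (insert w s \ {v, w}).eq_empty_or_nonempty with h | h
        · exact Or.inl h
        · refine Or.inr (subset_mem_faces hs (fun u hu => ?_) h)
          simp only [Finset.mem_insert, Finset.mem_sdiff, Finset.mem_singleton, not_or] at hu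
          exact hu.1.resolve_left hu.2.2
      · refine subset_mem_faces hs (fun u hu => ?_) (by simp)
        simp only [Finset.mem_insert, Finset.mem_sdiff, Finset.mem_singleton, not_or] at hu
        rcases hu with rfl | hu
        · exact hvs
        · exact hu.1.resolve_left hu.2.2
      · simp only [Finset.mem_insert, not_or] at hu
        simp only [q, if_neg hu.1, if_neg (fun h => hu.2 (h ▸ hvs) : u ≠ v)]
        exact hy u hu.2
    · have hyv := hy v hvs
      -- The coordinate at `v` is zero, so only one copy can become positive; the sign of `t`
      -- decides which.
      obtain ⟨a, ha, hat⟩ : ∃ a, (a = v ∨ a = w) ∧ ∀ u, u ∉ insert a s → q y t u = 0 := by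
        rcases le_total t 0 with ht | ht
        · refine ⟨w, Or.inr rfl, fun u hu => ?_⟩
          simp only [Finset.mem_insert, not_or] at hu
          simp only [q, if_neg hu.1, hyv, max_eq_right ht]
          split_ifs
          · simp
          · exact hy u hu.2
        · refine ⟨v, Or.inl rfl, fun u hu => ?_⟩
          simp only [Finset.mem_insert, not_or] at hu
          simp only [q, if_neg hu.1, hyv, max_eq_right (neg_nonpos.2 ht)]
          split_ifs
          · simp
          · exact hy u hu.2
      have hsd : insert a s \ {v, w} = s := by
        ext u
        simp only [Finset.mem_insert, Finset.mem_sdiff, Finset.mem_singleton, not_or]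
        constructor
        · rintro ⟨h1 | h1, h2, h3⟩
          · rcases ha with rfl | rfl
            exacts [absurd h1 h2, absurd h1 h3]
          · exact h1
        · intro h
          exact ⟨Or.inr h, fun e => hvs (e ▸ h), fun e => hsw (e ▸ h)⟩
      refine ⟨insert a s, ⟨by simp, Or.inr (by rwa [hsd]), fun h1 h2 => ?_⟩, hat⟩
      rcases ha with rfl | rfl
      · exact absurd h2 (by simp [hsw, hvw.symm])
      · exact absurd h1 (by simp [hvs, hvw])
  have qp : ∀ x, q (p x) (x v - x w) = x := by
    intro x
    ext u
    simp only [q, p, if_neg hvw, if_true]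
    split_ifs with h1 h2
    · subst h1
      rcases le_total (x v) (x u) with h | h
      · rw [min_eq_left h, max_eq_left (by linarith)]
        ring
      · rw [min_eq_right h, max_eq_right (by linarith)]
        ring
    · subst h2
      rcases le_total (x u) (x w) with h | h
      · rw [min_eq_left h, max_eq_right (by linarith)]
        ring
      · rw [min_eq_right h, max_eq_left (by linarith)]
        ring
    · rfl
  have pq : ∀ y ∈ K.cone, ∀ t, p (q y t) = y := by
    rintro y ⟨h0, s, hs, hy⟩ t
    ext u
    simp only [q, p, if_neg hvw, if_true]
    split_ifs with h1 h2
    · rw [h1, hy w (hwK s hs)]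
    · rw [h2]
      rcases le_total t 0 with h | h
      · rw [max_eq_right h, max_eq_left (by linarith), min_eq_left (by linarith), add_zero]
      · rw [max_eq_left h, max_eq_right (by linarith), min_eq_right (by linarith), add_zero]
    · rfl
  have dq : ∀ y t, q y t v - q y t w = t := by
    intro y t
    simp only [q, if_neg hvw, if_true]
    rcases le_total t 0 with h | h
    · rw [max_eq_right h, max_eq_left (by linarith)]
      ring
    · rw [max_eq_left h, max_eq_right (by linarith)]
      ring
  have psmul : ∀ c : ℝ, 0 ≤ c → ∀ x, p (c • x) = c • p x := by
    intro c hc x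
    ext u
    simp only [p, Pi.smul_apply, smul_eq_mul]
    split_ifs
    · simp
    · rw [mul_min_of_nonneg _ _ hc]
    · rfl
  refine ⟨fun x => Fin.cons (x v - x w) (f (p x)), fun z => q (g (Fin.tail z)) (z 0),
    ?_, ?_, fun _ _ => trivial, fun z _ => qmem _ (mg trivial) _, ?_, ?_, ?_⟩
  · have h1 : ContinuousOn (fun x => f (p x)) (K.onePointSuspension v w).cone :=
      hf.comp hp.continuousOn pmem
    refine continuousOn_pi.2 fun i => ?_
    refine Fin.cases ?_ (fun i => ?_) i
    · simp only [Fin.cons_zero]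
      fun_prop
    · simp only [Fin.cons_succ]
      exact continuousOn_pi.1 h1 i
  · have hgc : Continuous g := continuousOn_univ.1 hg
    have h2 : Continuous fun z : Fin (n + 1) → ℝ => (Fin.tail z : Fin n → ℝ) :=
      continuous_pi fun i => continuous_apply _
    exact (hq.comp ((hgc.comp h2).prodMk (continuous_apply 0))).continuousOn
  · intro x hx
    simp only [Fin.tail_cons, Fin.cons_zero]
    rw [gf (pmem x hx), qp]
  · intro z _
    simp only
    rw [pq _ (mg trivial), dq, fg trivial, Fin.cons_self_tail]
  · intro c hc x hx
    ext i
    refine Fin.cases ?_ (fun i => ?_) i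
    · simp
      ring
    · simp only [Fin.cons_succ, Pi.smul_apply, psmul c hc, hom c hc _ (pmem x hx)]

end Wedge

/-! ### Bistellar flips and the boundary of a simplex -/

section Flip

variable {V : Type*} [DecidableEq V]

/-- Subtract `c` from the coordinates in `σ`, and add it to those in `τ`. -/
def shift (σ τ : Finset V) (c : ℝ) (x : V → ℝ) : V → ℝ := fun u =>
  x u - (if u ∈ σ then c else 0) + if u ∈ τ then c else 0

/-- Disjointness keeps the subtraction away from `σ`, so all its coordinates move by the same
amount. Hence the minimum moved by a flip can be read off afterwards and moved back. -/
theorem inf'_shift_left {σ τ : Finset V} (hσ : σ.Nonempty) (hd : Disjoint σ τ) (c : ℝ)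
    (x : V → ℝ) : σ.inf' hσ (shift τ σ c x) = σ.inf' hσ x + c := by
  have h : ∀ u ∈ σ, shift τ σ c x u = x u + c := fun u hu => by
    simp [shift, hu, Finset.disjoint_left.1 hd hu]
  refine le_antisymm ?_ ((Finset.le_inf'_iff hσ _).2 fun u hu => ?_)
  · rw [← sub_le_iff_le_add]
    refine (Finset.le_inf'_iff hσ _).2 fun u hu => ?_
    rw [sub_le_iff_le_add, ← h u hu]
    exact Finset.inf'_le _ hu
  · rw [h u hu]
    gcongr
    exact Finset.inf'_le _ hu

/-- A bistellar flip exchanging `σ` and `τ` does not change the cone up to homeomorphism. -/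
theorem coneEquiv_of_flip {K L : PreAbstractSimplicialComplex V} {σ τ : Finset V}
    (hσ : σ.Nonempty) (hτ : τ.Nonempty) (hd : Disjoint σ τ) (hK : ∀ s ∈ K.faces, ¬ τ ⊆ s)
    (hL : ∀ s ∈ L.faces, ¬ σ ⊆ s)
    (hKL : ∀ s ∈ K.faces, s ∈ L.faces ∨ ∀ a ∈ σ, s \ {a} ∪ τ ∈ L.faces)
    (hLK : ∀ s ∈ L.faces, s ∈ K.faces ∨ ∀ a ∈ τ, s \ {a} ∪ σ ∈ K.faces) :
    ConeEquiv K.cone L.cone := by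
  -- The flip map moves the minimum over `σ` onto `τ`. Its range is treated for arbitrary complexes
  -- so that the reverse flip is covered as well.
  have key : ∀ {K L : PreAbstractSimplicialComplex V} {σ τ : Finset V} (hσ : σ.Nonempty)
      (_ : Disjoint σ τ) (_ : ∀ s ∈ L.faces, ¬ σ ⊆ s)
      (_ : ∀ s ∈ K.faces, s ∈ L.faces ∨ ∀ a ∈ σ, s \ {a} ∪ τ ∈ L.faces) (x : V → ℝ),
      x ∈ K.cone → shift σ τ (σ.inf' hσ x) x ∈ L.cone := by
    intro K L σ τ hσ hd hL hKL x hx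
    obtain ⟨h0, s, hs, hx⟩ := hx
    have hm : 0 ≤ σ.inf' hσ x := (Finset.le_inf'_iff hσ _).2 fun u _ => h0 u
    refine ⟨fun u => ?_, ?_⟩
    · simp only [shift]
      by_cases hu : u ∈ σ
      · have := Finset.inf'_le x hu
        simp only [hu, if_true]
        split_ifs <;> linarith [h0 u]
      · have := h0 u
        simp only [hu, if_false]
        split_ifs <;> linarith
    · rcases hKL s hs with hsL | hsL
      · have : σ.inf' hσ x = 0 := inf'_eq_zero_of_mem_cone hσ hL ⟨h0, s, hsL, hx⟩
        exact ⟨s, hsL, fun u hu => by simp [shift, this, hx u hu]⟩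
      -- A vertex `a` attaining the minimum drops out of the support, while all of `τ` may enter.
      · obtain ⟨a, ha, hax⟩ := Finset.exists_mem_eq_inf' hσ x
        refine ⟨_, hsL a ha, fun u hu => ?_⟩
        simp only [Finset.mem_union, Finset.mem_sdiff, Finset.mem_singleton, not_or, not_and,
          not_not] at hu
        simp only [shift, hu.2, if_false, add_zero]
        by_cases hus : u ∈ s
        · rw [hu.1 hus, if_pos ha, hax, sub_self]
        · rw [hx u hus]
          split_ifs with h
          · have h1 : σ.inf' hσ x ≤ 0 := (hx u hus) ▸ Finset.inf'_le x h
            linarith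
          · simp
  have hcont : ∀ (σ τ : Finset V) (hσ : σ.Nonempty),
      Continuous fun x : V → ℝ => shift σ τ (σ.inf' hσ x) x := by
    intro σ τ hσ
    have h1 : Continuous fun x : V → ℝ => σ.inf' hσ x :=
      Continuous.finset_inf'_apply hσ fun i _ => continuous_apply i
    refine continuous_pi fun u => ?_
    simp only [shift]
    split_ifs <;> fun_prop
  have hinv : ∀ {K : PreAbstractSimplicialComplex V} {σ τ : Finset V} (hσ : σ.Nonempty)
      (hτ : τ.Nonempty) (_ : Disjoint σ τ) (_ : ∀ s ∈ K.faces, ¬ τ ⊆ s) (x : V → ℝ), x ∈ K.cone →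
      shift τ σ (τ.inf' hτ (shift σ τ (σ.inf' hσ x) x)) (shift σ τ (σ.inf' hσ x) x) = x := by
    intro K σ τ hσ hτ hd hK x hx
    rw [inf'_shift_left hτ hd.symm, inf'_eq_zero_of_mem_cone hτ hK hx, zero_add]
    ext u
    simp only [shift]
    ring
  refine ⟨fun x => shift σ τ (σ.inf' hσ x) x, fun x => shift τ σ (τ.inf' hτ x) x,
    (hcont σ τ hσ).continuousOn, (hcont τ σ hτ).continuousOn, key hσ hd hL hKL,
    key hτ hd.symm hK hLK, hinv hσ hτ hd hK, hinv hτ hσ hd.symm hL, ?_⟩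
  intro c hc x _
  have h1 : σ.inf' hσ (c • x) = c * σ.inf' hσ x := by
    refine le_antisymm ?_ ((Finset.le_inf'_iff hσ _).2 fun u hu => ?_)
    · obtain ⟨a, ha, hax⟩ := Finset.exists_mem_eq_inf' hσ x
      rw [hax]
      exact Finset.inf'_le (c • x) ha
    · exact mul_le_mul_of_nonneg_left (Finset.inf'_le x hu) hc
  ext u
  simp only [h1]
  simp only [shift, Pi.smul_apply, smul_eq_mul]
  split_ifs <;> ring

/-- The cone over the boundary of an `n`-simplex is homeomorphic to `ℝⁿ`. -/
theorem coneEquiv_of_simplex_boundary {K : PreAbstractSimplicialComplex V} {T : Finset V} {n : ℕ}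
    (hn : 0 < n) (hT : T.card = n + 1) (hK : ∀ s, s ∈ K.faces ↔ s.Nonempty ∧ s ⊂ T) :
    ConeEquiv K.cone (Set.univ : Set (Fin n → ℝ)) := by
  have hTne : T.Nonempty := Finset.card_pos.1 (by omega)
  obtain ⟨o, ho⟩ := id hTne
  have hcard : (T.erase o).card = n := by rw [Finset.card_erase_of_mem ho, hT]; rfl
  let e : (T.erase o : Finset V) ≃ Fin n := (T.erase o).equivFinOfCardEq hcard
  let ext : (Fin n → ℝ) → V → ℝ := fun y u => if h : u ∈ T.erase o then y (e ⟨u, h⟩) else 0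
  have ext_o : ∀ y, ext y o = 0 := fun y => by simp [ext]
  have ext_cont : Continuous ext := by
    refine continuous_pi fun u => ?_
    simp only [ext]
    split_ifs <;> fun_prop
  -- This inverts `x ↦ (x i - x o)`: those differences determine `x` on `T` up to a common constant,
  -- which is fixed by requiring minimum 0 on `T`, as holds on the boundary.
  let g : (Fin n → ℝ) → V → ℝ := fun y u => if u ∈ T then ext y u - T.inf' hTne (ext y) else 0
  have g_cont : Continuous g := by
    have h1 : Continuous fun y => T.inf' hTne (ext y) :=
      Continuous.finset_inf'_apply hTne fun i _ => (continuous_apply i).comp ext_cont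
    refine continuous_pi fun u => ?_
    simp only [g]
    split_ifs
    · exact ((continuous_apply u).comp ext_cont).sub h1
    · fun_prop
  refine ⟨fun x i => x (e.symm i) - x o, g, ?_, g_cont.continuousOn, fun _ _ => trivial, ?_, ?_,
    ?_, ?_⟩
  · exact (continuous_pi fun i => by fun_prop).continuousOn
  · intro y _
    obtain ⟨a, ha, hax⟩ := Finset.exists_mem_eq_inf' hTne (ext y)
    refine ⟨fun u => ?_, T.erase a, (hK _).2 ⟨?_, Finset.erase_ssubset ha⟩, fun u hu => ?_⟩
    · simp only [g]
      split_ifs with h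
      exacts [sub_nonneg.2 (Finset.inf'_le _ h), le_rfl]
    · rw [← Finset.card_pos, Finset.card_erase_of_mem ha]
      omega
    · simp only [g]
      split_ifs with h
      · have : u = a := by
          by_contra hne
          exact hu (Finset.mem_erase.2 ⟨hne, h⟩)
        rw [hax, this, sub_self]
      · rfl
  · intro x hx
    have h0 : T.inf' hTne x = 0 :=
      inf'_eq_zero_of_mem_cone hTne (fun s hs => ((hK s).1 hs).2.2) hx
    have h1 : ∀ u ∈ T, ext (fun i => x (e.symm i) - x o) u = x u - x o := by
      intro u hu
      by_cases huo : u = o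
      · rw [huo, sub_self]
        simp [ext]
      · have : u ∈ T.erase o := Finset.mem_erase.2 ⟨huo, hu⟩
        simp [ext, hu, huo]
    have h2 : T.inf' hTne (ext fun i => x (e.symm i) - x o) = - x o := by
      refine le_antisymm ?_ ((Finset.le_inf'_iff hTne _).2 fun u hu => ?_)
      · obtain ⟨a, ha, hax⟩ := Finset.exists_mem_eq_inf' hTne x
        have := Finset.inf'_le (ext fun i => x (e.symm i) - x o) ha
        rw [h1 a ha, ← hax, h0, zero_sub] at this
        exact this
      · rw [h1 u hu]
        linarith [hx.1 u]
    ext u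
    simp only [g]
    split_ifs with hu
    · rw [h2, h1 u hu]
      ring
    · obtain ⟨-, s, hs, hxs⟩ := hx
      exact (hxs u fun h => hu (((hK s).1 hs).2.1 h)).symm
  · intro y _
    funext i
    have hi := (e.symm i).2
    have h1 : ext y (e.symm i) = y i := by
      simp only [ext, dif_pos hi]
      simp
    simp only [g, if_pos ho, if_pos (Finset.mem_of_mem_erase hi), ext_o, h1]
    ring
  · intro c _ x _
    funext i
    simp only [Pi.smul_apply, smul_eq_mul]
    ring

end Flip

end PreAbstractSimplicialComplex

/-! ### Facets, ridge-graphs and convex sequences under wedging -/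

namespace PreAbstractSimplicialComplex

/-- Two finite sets of the same size that differ by at most one exchange of elements. -/
def ExchangeAdj {V : Type*} [DecidableEq V] (s t : Finset V) : Prop :=
  s.card = t.card ∧ (s \ t).card ≤ 1

/-- A sequence of facets from `A` to `B`, at each step staying or moving to an adjacent facet, in
which every vertex is present during an interval. -/
def HasConvexSequence {V : Type*} [DecidableEq V] (K : PreAbstractSimplicialComplex V)
    (A B : Finset V) : Prop :=
  ∃ (N : ℕ) (f : ℕ → Finset V), f 0 = A ∧ f N = B ∧ (∀ i ≤ N, K.IsFacet (f i)) ∧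
    (∀ i < N, ExchangeAdj (f i) (f (i + 1))) ∧
    ∀ i j k, i ≤ j → j ≤ k → k ≤ N → ∀ x ∈ f i, x ∈ f k → x ∈ f j

section

variable {V : Type*} {K : PreAbstractSimplicialComplex V}

theorem IsFacet.eq_of_subset {s t : Finset V} (hs : K.IsFacet s) (ht : t ∈ K.faces)
    (h : s ⊆ t) : s = t :=
  h.antisymm (hs.2 ht h)

theorem notMem_of_mem_faces {w : V} (hw : w ∉ K.vertexSet) {s : Finset V} (hs : s ∈ K.faces) : w ∉ s :=
  fun h => hw (singleton_mem_faces hs h)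

end

section

variable {V : Type*} [DecidableEq V] {K : PreAbstractSimplicialComplex V} {v w : V}

theorem exchangeAdj_of_adj {F G : {s : Finset V // K.IsFacet s}} (h : K.ridgeGraph.Adj F G) :
    ExchangeAdj F.1 G.1 := by
  have h1 : (F.1 ∩ G.1).card + 1 = F.1.card ∧ (F.1 ∩ G.1).card + 1 = G.1.card := h
  refine ⟨by omega, ?_⟩
  have := Finset.card_sdiff_add_card_inter F.1 G.1
  omega

theorem adj_of_exchangeAdj {F G : {s : Finset V // K.IsFacet s}} (hne : F ≠ G)
    (h : ExchangeAdj F.1 G.1) : K.ridgeGraph.Adj F G := by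
  have h1 := Finset.card_sdiff_add_card_inter F.1 G.1
  have h2 := Finset.card_sdiff_add_card_inter G.1 F.1
  rw [Finset.inter_comm] at h2
  have h3 : (F.1 \ G.1).card ≠ 0 := by
    intro h0
    rw [Finset.card_eq_zero, Finset.sdiff_eq_empty_iff_subset] at h0
    exact hne (Subtype.ext (Finset.eq_of_subset_of_card_le h0 h.1.ge))
  obtain ⟨h4, h5⟩ := h
  change (F.1 ∩ G.1).card + 1 = F.1.card ∧ (F.1 ∩ G.1).card + 1 = G.1.card
  omega

theorem vertexSet_onePointSuspension (hv : v ∈ K.vertexSet) :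
    (K.onePointSuspension v w).vertexSet = insert w K.vertexSet := by
  have hv' : {v} ∈ K.faces := hv
  ext x
  change (({x} : Finset V).Nonempty ∧ ({x} \ {v, w} = (∅ : Finset V) ∨ {x} \ {v, w} ∈ K.faces) ∧
    (v ∈ ({x} : Finset V) → w ∈ ({x} : Finset V) → insert v ({x} \ {v, w}) ∈ K.faces)) ↔
    x = w ∨ {x} ∈ K.faces
  by_cases hxw : x = w
  · subst hxw
    simp only [Finset.singleton_nonempty, true_and, true_or, iff_true]
    have : ({x} : Finset V) \ {v, x} = ∅ := by simp
    rw [this]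
    exact ⟨Or.inl rfl, fun _ _ => by simpa using hv'⟩
  · by_cases hxv : x = v
    · subst hxv
      have : ({x} : Finset V) \ {x, w} = ∅ := by simp
      simp [hv', this]
    · have : ({x} : Finset V) \ {v, w} = {x} := by
        rw [Finset.sdiff_eq_self_iff_disjoint]
        simp [hxv, hxw]
      rw [this]
      simp [hxw, Ne.symm hxv]

theorem finite_onePointSuspension (hK : K.faces.Finite) :
    (K.onePointSuspension v w).faces.Finite := by
  obtain ⟨T, hT⟩ : ∃ T : Finset V, ∀ s ∈ K.faces, s ⊆ T :=
    ⟨hK.toFinset.biUnion id, fun s hs => Finset.subset_biUnion_of_mem id (by simpa using hs)⟩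
  refine (insert v (insert w T)).powerset.finite_toSet.subset fun s hs => ?_
  simp only [Finset.coe_powerset, Set.mem_preimage, Set.mem_powerset_iff, Finset.coe_subset]
  intro x hx
  by_cases hxvw : x ∈ ({v, w} : Finset V)
  · simp only [Finset.mem_insert, Finset.mem_singleton] at hxvw ⊢
    tauto
  · have hx' : x ∈ s \ {v, w} := Finset.mem_sdiff.2 ⟨hx, hxvw⟩
    rcases hs.2.1 with h | h
    · simp [h] at hx'
    · exact Finset.mem_insert_of_mem (Finset.mem_insert_of_mem (hT _ h hx'))

/-- The facet of `K` under a facet of its one-point suspension. -/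
def collapse (v w : V) (s : Finset V) : Finset V :=
  if v ∈ s ∧ w ∈ s then s.erase w else s \ {v, w}

theorem mem_collapse (hvw : v ≠ w) {s : Finset V} {x : V} :
    x ∈ collapse v w s ↔ x ≠ w ∧ x ∈ s ∧ (x = v → w ∈ s) := by
  unfold collapse
  split_ifs with h
  · simp only [Finset.mem_erase]
    tauto
  · simp only [Finset.mem_sdiff, Finset.mem_insert, Finset.mem_singleton]
    constructor
    · tauto
    · rintro ⟨h1, h2, h3⟩
      refine ⟨h2, ?_⟩
      rintro (rfl | rfl)
      · exact h ⟨h2, h3 rfl⟩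
      · exact h1 rfl

/-- A face avoiding both copies can be enlarged by `v`. -/
theorem mem_or_mem_of_isFacet (hv : v ∈ K.vertexSet) (hw : w ∉ K.vertexSet) {s : Finset V}
    (hs : (K.onePointSuspension v w).IsFacet s) : v ∈ s ∨ w ∈ s := by
  by_contra! h
  have hsd : s \ {v, w} = s := by
    rw [Finset.sdiff_eq_self_iff_disjoint]
    simp [h.1, h.2]
  have hvw : v ≠ w := by
    rintro rfl
    exact hw hv
  have hins : insert v s ∈ (K.onePointSuspension v w).faces := by
    refine ⟨by simp, ?_, fun _ h2 => absurd h2 (by simp [h.2, hvw.symm])⟩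
    have : insert v s \ {v, w} = s := by
      rw [Finset.insert_sdiff_of_mem _ (by simp), hsd]
    rw [this]
    have := hs.1.2.1
    rwa [hsd] at this
  exact h.1 (hs.2 hins (Finset.subset_insert _ _) (Finset.mem_insert_self _ _))

theorem card_collapse (hv : v ∈ K.vertexSet) (hw : w ∉ K.vertexSet) {s : Finset V}
    (hs : (K.onePointSuspension v w).IsFacet s) : (collapse v w s).card + 1 = s.card := by
  have hvw : v ≠ w := by
    rintro rfl
    exact hw hv
  unfold collapse
  split_ifs with h
  · exact Finset.card_erase_add_one h.2
  · rcases mem_or_mem_of_isFacet hv hw hs with h1 | h1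
    · have h2 : w ∉ s := fun h2 => h ⟨h1, h2⟩
      have : s \ {v, w} = s.erase v := by
        ext x
        simp only [Finset.mem_sdiff, Finset.mem_insert, Finset.mem_singleton, Finset.mem_erase]
        constructor
        · tauto
        · rintro ⟨h3, h4⟩
          refine ⟨h4, ?_⟩
          rintro (rfl | rfl)
          exacts [h3 rfl, h2 h4]
      rw [this, Finset.card_erase_add_one h1]
    · have h2 : v ∉ s := fun h2 => h ⟨h2, h1⟩
      have : s \ {v, w} = s.erase w := by
        ext x
        simp only [Finset.mem_sdiff, Finset.mem_insert, Finset.mem_singleton, Finset.mem_erase]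
        constructor
        · tauto
        · rintro ⟨h3, h4⟩
          refine ⟨h4, ?_⟩
          rintro (rfl | rfl)
          exacts [h2 h4, h3 rfl]
      rw [this, Finset.card_erase_add_one h1]

/-- Adding the new vertex to a face of `K` gives a face of the one-point suspension. -/
theorem insert_new_mem_faces (hv : v ∈ K.vertexSet) (hw : w ∉ K.vertexSet) {s : Finset V}
    (hs : s ∈ K.faces) : insert w s ∈ (K.onePointSuspension v w).faces := by
  have hws := notMem_of_mem_faces hw hs
  have hvw : v ≠ w := by
    rintro rfl
    exact hw hv
  refine ⟨by simp, ?_, fun h _ => ?_⟩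
  · rcases (insert w s \ {v, w}).eq_empty_or_nonempty with h | h
    · exact Or.inl h
    · refine Or.inr (subset_mem_faces hs (fun u hu => ?_) h)
      simp only [Finset.mem_insert, Finset.mem_sdiff, Finset.mem_singleton, not_or] at hu
      exact hu.1.resolve_left hu.2.2
  · have hvs : v ∈ s := (Finset.mem_insert.1 h).resolve_left hvw
    refine subset_mem_faces hs (fun u hu => ?_) (by simp)
    simp only [Finset.mem_insert, Finset.mem_sdiff, Finset.mem_singleton, not_or] at hu
    rcases hu with rfl | hu
    · exact hvs
    · exact hu.1.resolve_left hu.2.2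

theorem insert_old_mem_faces (hv : v ∈ K.vertexSet) (hw : w ∉ K.vertexSet) {s : Finset V}
    (hs : s ∈ K.faces) (hvs : v ∉ s) : insert v s ∈ (K.onePointSuspension v w).faces := by
  have hws := notMem_of_mem_faces hw hs
  have hvw : v ≠ w := by
    rintro rfl
    exact hw hv
  refine ⟨by simp, Or.inr ?_, fun _ h => ?_⟩
  · have : insert v s \ {v, w} = s := by
      rw [Finset.insert_sdiff_of_mem _ (by simp), Finset.sdiff_eq_self_iff_disjoint]
      simp [hvs, hws]
    rwa [this]
  · exact absurd ((Finset.mem_insert.1 h).resolve_left hvw.symm) hws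

theorem collapse_mem_faces (hvw : v ≠ w) {s : Finset V}
    (hs : s ∈ (K.onePointSuspension v w).faces) :
    collapse v w s = ∅ ∨ collapse v w s ∈ K.faces := by
  unfold collapse
  split_ifs with h
  · have : s.erase w = insert v (s \ {v, w}) := by
      ext x
      simp only [Finset.mem_sdiff, Finset.mem_insert, Finset.mem_singleton, Finset.mem_erase]
      constructor
      · tauto
      · rintro (rfl | ⟨h1, h2⟩)
        · exact ⟨hvw, h.1⟩
        · tauto
    rw [this]
    exact Or.inr (hs.2.2 h.1 h.2)
  · exact hs.2.1

theorem isFacet_insert_new (hv : v ∈ K.vertexSet) (hw : w ∉ K.vertexSet) {s : Finset V}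
    (hs : K.IsFacet s) : (K.onePointSuspension v w).IsFacet (insert w s) := by
  have hws := notMem_of_mem_faces hw hs.1
  have hvw : v ≠ w := by
    rintro rfl
    exact hw hv
  refine ⟨insert_new_mem_faces hv hw hs.1, fun t ht hst => ?_⟩
  have hwt : w ∈ t := hst (Finset.mem_insert_self _ _)
  have hsc : s ⊆ collapse v w t := fun x hx => (mem_collapse hvw).2
    ⟨fun e => hws (e ▸ hx), hst (Finset.mem_insert_of_mem hx), fun _ => hwt⟩
  rcases collapse_mem_faces hvw ht with h | h
  · rw [h, Finset.subset_empty] at hsc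
    exact absurd hsc (nonempty_of_mem_faces hs.1).ne_empty
  · have := hs.2 h hsc
    intro x hx
    by_cases hxw : x = w
    · simp [hxw]
    · exact Finset.mem_insert_of_mem (this ((mem_collapse hvw).2 ⟨hxw, hx, fun _ => hwt⟩))

theorem isFacet_insert_old (hv : v ∈ K.vertexSet) (hw : w ∉ K.vertexSet) {s : Finset V}
    (hs : K.IsFacet s) (hvs : v ∉ s) : (K.onePointSuspension v w).IsFacet (insert v s) := by
  have hws := notMem_of_mem_faces hw hs.1
  have hvw : v ≠ w := by
    rintro rfl
    exact hw hv
  refine ⟨insert_old_mem_faces hv hw hs.1 hvs, fun t ht hst => ?_⟩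
  have hvt : v ∈ t := hst (Finset.mem_insert_self _ _)
  have hsc : s ⊆ collapse v w t := fun x hx => (mem_collapse hvw).2
    ⟨fun e => hws (e ▸ hx), hst (Finset.mem_insert_of_mem hx), fun e => absurd (e ▸ hx) hvs⟩
  rcases collapse_mem_faces hvw ht with h | h
  · rw [h, Finset.subset_empty] at hsc
    exact absurd hsc (nonempty_of_mem_faces hs.1).ne_empty
  · have heq := hs.eq_of_subset h hsc
    have hwt : w ∉ t := fun hwt => hvs (heq ▸ (mem_collapse hvw).2 ⟨hvw, hvt, fun _ => hwt⟩)
    intro x hx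
    by_cases hxv : x = v
    · simp [hxv]
    · refine Finset.mem_insert_of_mem (heq ▸ (mem_collapse hvw).2 ⟨?_, hx, fun e => absurd e hxv⟩)
      rintro rfl
      exact hwt hx

/-- A face of `K` properly above the collapse lifts, by adding `w` or `v`, to a face properly above
`s`. -/
theorem isFacet_collapse (hv : v ∈ K.vertexSet) (hw : w ∉ K.vertexSet) {s : Finset V}
    (hs : (K.onePointSuspension v w).IsFacet s) : K.IsFacet (collapse v w s) := by
  have hvw : v ≠ w := by
    rintro rfl
    exact hw hv
  have hvf : {v} ∈ K.faces := hv
  by_cases h : v ∈ s ∧ w ∈ s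
  · have hc : collapse v w s ∈ K.faces := by
      refine (collapse_mem_faces hvw hs.1).resolve_left fun h0 => ?_
      have : v ∈ collapse v w s := (mem_collapse hvw).2 ⟨hvw, h.1, fun _ => h.2⟩
      simp [h0] at this
    refine ⟨hc, fun t ht hst x hx => ?_⟩
    have hwt := notMem_of_mem_faces hw ht
    have hle : s ⊆ insert w t := fun y hy => by
      by_cases hyw : y = w
      · simp [hyw]
      · exact Finset.mem_insert_of_mem (hst ((mem_collapse hvw).2 ⟨hyw, hy, fun _ => h.2⟩))
    have := hs.2 (insert_new_mem_faces hv hw ht) hle (Finset.mem_insert_of_mem hx)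
    exact (mem_collapse hvw).2 ⟨fun e => hwt (e ▸ hx), this, fun _ => h.2⟩
  · have hvc : v ∉ collapse v w s := fun hm => by
      obtain ⟨-, h1, h2⟩ := (mem_collapse hvw).1 hm
      exact h ⟨h1, h2 rfl⟩
    have hs_sub : ∀ t, collapse v w s ⊆ t → ∀ y ∈ s, y ≠ v → y ≠ w → y ∈ t := fun t ht y hy h1 h2 =>
      ht ((mem_collapse hvw).2 ⟨h2, hy, fun e => absurd e h1⟩)
    -- If `v ∈ t`, then `insert w t` is a face above `s` containing both copies, against the
    -- maximality of `s` and the case assumption.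
    have hmax : ∀ t ∈ K.faces, collapse v w s ⊆ t → v ∉ t ∧ t ⊆ collapse v w s := by
      intro t ht hst
      have hwt := notMem_of_mem_faces hw ht
      have hvt : v ∉ t := by
        intro hvt
        have hle : s ⊆ insert w t := fun y hy => by
          by_cases hyw : y = w
          · simp [hyw]
          by_cases hyv : y = v
          · simp [hyv, hvt]
          exact Finset.mem_insert_of_mem (hs_sub t hst y hy hyv hyw)
        have hle' := hs.2 (insert_new_mem_faces hv hw ht) hle
        exact h ⟨hle' (Finset.mem_insert_of_mem hvt), hle' (Finset.mem_insert_self _ _)⟩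
      refine ⟨hvt, fun x hx => (mem_collapse hvw).2 ⟨fun e => hwt (e ▸ hx), ?_,
        fun e => absurd (e ▸ hx) hvt⟩⟩
      rcases mem_or_mem_of_isFacet hv hw hs with h1 | h1
      · refine hs.2 (insert_old_mem_faces hv hw ht hvt) (fun y hy => ?_)
          (Finset.mem_insert_of_mem hx)
        by_cases hyv : y = v
        · simp [hyv]
        · refine Finset.mem_insert_of_mem (hs_sub t hst y hy hyv ?_)
          rintro rfl
          exact h ⟨h1, hy⟩
      · refine hs.2 (insert_new_mem_faces hv hw ht) (fun y hy => ?_)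
          (Finset.mem_insert_of_mem hx)
        by_cases hyw : y = w
        · simp [hyw]
        · refine Finset.mem_insert_of_mem (hs_sub t hst y hy ?_ hyw)
          rintro rfl
          exact h ⟨hy, h1⟩
    have hc : collapse v w s ∈ K.faces := by
      refine (collapse_mem_faces hvw hs.1).resolve_left fun h0 => ?_
      -- An empty collapse would lie below the face `{v}`, but no face above the collapse contains
      -- `v`.
      exact (hmax {v} hvf (by simp [h0])).1 (by simp)
    exact ⟨hc, fun t ht hst => (hmax t ht hst).2⟩

theorem exchangeAdj_collapse (hv : v ∈ K.vertexSet) (hw : w ∉ K.vertexSet) {s t : Finset V}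
    (hs : (K.onePointSuspension v w).IsFacet s) (ht : (K.onePointSuspension v w).IsFacet t)
    (h : ExchangeAdj s t) : ExchangeAdj (collapse v w s) (collapse v w t) := by
  have hvw : v ≠ w := by
    rintro rfl
    exact hw hv
  have h1 := card_collapse hv hw hs
  have h2 := card_collapse hv hw ht
  refine ⟨by have := h.1; omega, Finset.card_le_one.2 fun a ha b hb => ?_⟩
  have h3 := Finset.card_le_one.1 h.2
  simp only [Finset.mem_sdiff, mem_collapse hvw] at ha hb h3
  -- A vertex disappears from the collapse either because it leaves the facet, or because it is `v`
  -- and its partner `w` leaves. At most one vertex leaves, so the two causes exclude each other.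
  have hcase : ∀ x, (x ≠ w ∧ x ∈ s ∧ (x = v → w ∈ s)) ∧ ¬(x ≠ w ∧ x ∈ t ∧ (x = v → w ∈ t)) →
      (x ∈ s ∧ x ∉ t) ∨ (x = v ∧ w ∈ s ∧ w ∉ t) := by
    rintro x ⟨⟨h4, h5, h6⟩, h7⟩
    by_cases hxt : x ∈ t
    · right
      by_contra hne
      refine h7 ⟨h4, hxt, fun e => ?_⟩
      by_contra hwt
      exact hne ⟨e, h6 e, hwt⟩
    · exact Or.inl ⟨h5, hxt⟩
  rcases hcase a ha with h4 | h4 <;> rcases hcase b hb with h5 | h5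
  · exact h3 a h4 b h5
  · exact absurd (h3 a h4 w h5.2) ha.1.1
  · exact absurd (h3 b h5 w h4.2) hb.1.1
  · rw [h4.1, h5.1]

/-- In the collapsed sequence `v` is present exactly when both `v` and `w` are, and an intersection
of two intervals is an interval. Adjacent facets may collapse to the same one, which is why
`ExchangeAdj` allows equality. -/
theorem HasConvexSequence.of_onePointSuspension (hv : v ∈ K.vertexSet) (hw : w ∉ K.vertexSet)
    {A B : Finset V} (hvA : v ∉ A) (hvB : v ∉ B) (hwA : w ∉ A) (hwB : w ∉ B)
    (h : (K.onePointSuspension v w).HasConvexSequence (insert v A) (insert w B)) :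
    K.HasConvexSequence A B := by
  have hvw : v ≠ w := by
    rintro rfl
    exact hw hv
  obtain ⟨N, f, f0, fN, hf, hadj, hconv⟩ := h
  refine ⟨N, fun i => collapse v w (f i), ?_, ?_, fun i hi => isFacet_collapse hv hw (hf i hi),
    fun i hi => exchangeAdj_collapse hv hw (hf i hi.le) (hf _ hi) (hadj i hi), ?_⟩
  · ext x
    simp only [mem_collapse hvw, f0, Finset.mem_insert]
    constructor
    · rintro ⟨h1, h2 | h2, h3⟩
      · exact absurd (h3 h2) (by simp [hvw.symm, hwA])
      · exact h2
    · exact fun hx => ⟨fun e => hwA (e ▸ hx), Or.inr hx, fun e => absurd (e ▸ hx) hvA⟩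
  · ext x
    simp only [mem_collapse hvw, fN, Finset.mem_insert]
    constructor
    · rintro ⟨h1, h2, -⟩
      exact h2.resolve_left h1
    · exact fun hx => ⟨fun e => hwB (e ▸ hx), Or.inr hx, fun e => absurd (e ▸ hx) hvB⟩
  · intro i j k hij hjk hk x hxi hxk
    rw [mem_collapse hvw] at hxi hxk ⊢
    exact ⟨hxi.1, hconv i j k hij hjk hk x hxi.2.1 hxk.2.1, fun e =>
      hconv i j k hij hjk hk w (hxi.2.2 e) (hxk.2.2 e)⟩

/-- Adding `w` maps the ridge-graph of `K` into that of the wedge, and each facet of the wedge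
equals or is adjacent to the image of its collapse. -/
theorem connected_onePointSuspension (hv : v ∈ K.vertexSet) (hw : w ∉ K.vertexSet)
    (h : K.ridgeGraph.Connected) : (K.onePointSuspension v w).ridgeGraph.Connected := by
  have hvw : v ≠ w := by
    rintro rfl
    exact hw hv
  let φ : K.ridgeGraph →g (K.onePointSuspension v w).ridgeGraph :=
    { toFun := fun F => ⟨insert w F.1, isFacet_insert_new hv hw F.2⟩
      map_rel' := by
        intro F G hFG
        have hFG' : (F.1 ∩ G.1).card + 1 = F.1.card ∧ (F.1 ∩ G.1).card + 1 = G.1.card := hFG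
        have h1 := notMem_of_mem_faces hw F.2.1
        have h2 := notMem_of_mem_faces hw G.2.1
        change (insert w F.1 ∩ insert w G.1).card + 1 = (insert w F.1).card ∧
          (insert w F.1 ∩ insert w G.1).card + 1 = (insert w G.1).card
        rw [← Finset.insert_inter_distrib, Finset.card_insert_of_notMem h1,
          Finset.card_insert_of_notMem h2,
          Finset.card_insert_of_notMem (fun h => h1 (Finset.mem_inter.1 h).1)]
        omega }
  have hreach : ∀ S : {s : Finset V // (K.onePointSuspension v w).IsFacet s},
      ∃ F, (K.onePointSuspension v w).ridgeGraph.Reachable S (φ F) := by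
    rintro ⟨S, hS⟩
    have hF := isFacet_collapse hv hw hS
    refine ⟨⟨_, hF⟩, ?_⟩
    by_cases heq : S = insert w (collapse v w S)
    · have : (⟨S, hS⟩ : {s : Finset V // (K.onePointSuspension v w).IsFacet s}) =
          φ ⟨_, hF⟩ := Subtype.ext heq
      rw [← this]
    · refine SimpleGraph.Adj.reachable (adj_of_exchangeAdj (fun e => heq (congrArg Subtype.val e))
        ⟨?_, Finset.card_le_one.2 fun a ha b hb => ?_⟩)
      · change S.card = (insert w (collapse v w S)).card
        rw [Finset.card_insert_of_notMem (notMem_of_mem_faces hw hF.1), card_collapse hv hw hS]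
      · have key : ∀ x ∈ S \ insert w (collapse v w S), x = v := by
          intro x hx
          rw [Finset.mem_sdiff, Finset.mem_insert, mem_collapse hvw] at hx
          tauto
        rw [key a ha, key b hb]
  obtain ⟨F₀⟩ := h.nonempty
  have : Nonempty {s : Finset V // (K.onePointSuspension v w).IsFacet s} := ⟨φ F₀⟩
  refine SimpleGraph.Connected.mk fun S T => ?_
  obtain ⟨F, hF⟩ := hreach S
  obtain ⟨G, hG⟩ := hreach T
  exact hF.trans (((h.preconnected F G).map φ).trans hG.symm)

/-! ### Short paths between complementary facets -/

/-- A short sequence between complementary facets is a convex one. -/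
theorem convex_of_length_le {A B : Finset V} (hAB : Disjoint A B) {N : ℕ} {f : ℕ → Finset V}
    (f0 : f 0 = A) (fN : f N = B) (hsub : ∀ i ≤ N, f i ⊆ A ∪ B)
    (hadj : ∀ i < N, ExchangeAdj (f i) (f (i + 1))) (hN : N ≤ A.card) {i j k : ℕ} (hij : i ≤ j)
    (hjk : j ≤ k) (hk : k ≤ N) {x : V} (hi : x ∈ f i) (hxk : x ∈ f k) : x ∈ f j := by
  have hcard : ∀ i ≤ N, (f i).card = A.card := by
    intro i
    induction i with
    | zero => exact fun _ => by rw [f0]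
    | succ i ih => exact fun hi => by rw [← (hadj i hi).1, ih (by omega)]
  have hB : B.card = A.card := fN ▸ hcard N le_rfl
  have hloss : ∀ i < N, (f i \ f (i + 1)).card ≤ 1 ∧ (f (i + 1) \ f i).card ≤ 1 := by
    intro i hi
    refine ⟨(hadj i hi).2, ?_⟩
    rw [← Finset.card_sdiff_comm (hadj i hi).1]
    exact (hadj i hi).2
  have hstep : ∀ C : Finset V, ∀ i < N, (f i ∩ C).card ≤ (f (i + 1) ∩ C).card + 1 := by
    intro C i hi
    have h1 : f i ∩ C ⊆ (f (i + 1) ∩ C) ∪ (f i \ f (i + 1)) := by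
      intro y hy
      simp only [Finset.mem_union, Finset.mem_inter, Finset.mem_sdiff] at hy ⊢
      tauto
    have h2 := (Finset.card_le_card h1).trans (Finset.card_union_le _ _)
    have := (hloss i hi).1
    omega
  -- Each step loses at most one vertex of `A`: counted from the start this bounds `f i ∩ A` from
  -- below, counted back from `B` (in `hup`) from above. Since `N ≤ A.card`, the two bounds meet.
  have hlow : ∀ i ≤ N, A.card ≤ (f i ∩ A).card + i := by
    intro i
    induction i with
    | zero => exact fun _ => by simp [f0]
    | succ i ih =>
      intro hi
      have := ih (by omega)
      have := hstep A i hi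
      omega
  have hup : ∀ m ≤ N, (f (N - m) ∩ A).card ≤ m := by
    intro m
    induction m with
    | zero =>
      intro _
      rw [Nat.sub_zero, fN, Finset.inter_comm, Finset.disjoint_iff_inter_eq_empty.1 hAB]
      simp
    | succ m ih =>
      intro hm
      have h1 := ih (by omega)
      have h2 := hstep A (N - (m + 1)) (by omega)
      have h3 : N - (m + 1) + 1 = N - m := by omega
      rw [h3] at h2
      omega
  have hA : ∀ i ≤ N, (f i ∩ A).card + i = A.card := by
    intro i hi
    have h1 := hlow i hi
    have h2 := hup (N - i) (by omega)
    rw [Nat.sub_sub_self hi] at h2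
    omega
  have hBi : ∀ i ≤ N, (f i ∩ B).card = i := by
    intro i hi
    have h1 := hA i hi
    have h2 : f i = (f i ∩ A) ∪ (f i ∩ B) := by
      rw [← Finset.inter_union_distrib_left, Finset.inter_eq_left.2 (hsub i hi)]
    have h3 := congrArg Finset.card h2
    rw [Finset.card_union_of_disjoint (hAB.mono Finset.inter_subset_right
      Finset.inter_subset_right), hcard i hi] at h3
    omega
  -- The one vertex that leaves is used up by the drop in `f i ∩ A`, so no vertex of `A` can enter;
  -- dually, in `hupB`, none of `B` leaves.
  have hdown : ∀ i < N, f (i + 1) ∩ A ⊆ f i := by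
    intro i hi
    have h1 := hA i hi.le
    have h2 := hA (i + 1) hi
    have h3 := Finset.card_sdiff_add_card_inter (f i ∩ A) (f (i + 1) ∩ A)
    have h4 := Finset.card_sdiff_add_card_inter (f (i + 1) ∩ A) (f i ∩ A)
    rw [Finset.inter_comm (f (i + 1) ∩ A)] at h4
    have h5 : ((f i ∩ A) \ (f (i + 1) ∩ A)).card ≤ (f i \ f (i + 1)).card := by
      refine Finset.card_le_card fun y hy => ?_
      simp only [Finset.mem_inter, Finset.mem_sdiff] at hy ⊢
      tauto
    have h6 := (hloss i hi).1
    have h7 : ((f (i + 1) ∩ A) \ (f i ∩ A)).card = 0 := by omega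
    rw [Finset.card_eq_zero, Finset.sdiff_eq_empty_iff_subset] at h7
    exact h7.trans Finset.inter_subset_left
  have hupB : ∀ i < N, f i ∩ B ⊆ f (i + 1) := by
    intro i hi
    have h1 := hBi i hi.le
    have h2 := hBi (i + 1) hi
    have h3 := Finset.card_sdiff_add_card_inter (f i ∩ B) (f (i + 1) ∩ B)
    have h4 := Finset.card_sdiff_add_card_inter (f (i + 1) ∩ B) (f i ∩ B)
    rw [Finset.inter_comm (f (i + 1) ∩ B)] at h4
    have h5 : ((f (i + 1) ∩ B) \ (f i ∩ B)).card ≤ (f (i + 1) \ f i).card := by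
      refine Finset.card_le_card fun y hy => ?_
      simp only [Finset.mem_inter, Finset.mem_sdiff] at hy ⊢
      tauto
    have h6 := (hloss i hi).2
    have h7 : ((f i ∩ B) \ (f (i + 1) ∩ B)).card = 0 := by omega
    rw [Finset.card_eq_zero, Finset.sdiff_eq_empty_iff_subset] at h7
    exact h7.trans Finset.inter_subset_left
  rcases Finset.mem_union.1 (hsub k hk hxk) with hx | hx
  · refine Nat.decreasingInduction' (P := fun l => x ∈ f l) (fun l hl _ hxl => ?_) hjk hxk
    exact hdown l (by omega) (Finset.mem_inter.2 ⟨hxl, hx⟩)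
  · refine Nat.le_induction (P := fun l _ => l ≤ N → x ∈ f l) (fun _ => hi) (fun l _ ih hl => ?_) j
      hij (hjk.trans hk)
    exact hupB l hl (Finset.mem_inter.2 ⟨ih (by omega), hx⟩)

/-- If complementary facets with `n` vertices are not joined by a convex sequence, then the diameter
of the ridge-graph exceeds `n`. -/
theorem lt_diam_of_not_hasConvexSequence (hK : K.faces.Finite) (hconn : K.ridgeGraph.Connected)
    {A B : Finset V} (hA : K.IsFacet A) (hB : K.IsFacet B) (hAB : Disjoint A B)
    (hcov : ∀ x ∈ K.vertexSet, x ∈ A ∪ B) (h : ¬ K.HasConvexSequence A B) :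
    A.card < K.ridgeGraph.diam := by
  have : Finite {s : Finset V // K.IsFacet s} :=
    (hK.subset fun s (hs : K.IsFacet s) => hs.1 : {s | K.IsFacet s}.Finite).to_subtype
  have : Nonempty {s : Finset V // K.IsFacet s} := ⟨⟨A, hA⟩⟩
  -- Finiteness and connectedness are needed because an infinite diameter would be recorded as 0.
  have hdiam : K.ridgeGraph.ediam ≠ ⊤ := SimpleGraph.connected_iff_ediam_ne_top.1 hconn
  refine lt_of_lt_of_le ?_ (SimpleGraph.dist_le_diam (u := ⟨A, hA⟩) (v := ⟨B, hB⟩) hdiam)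
  by_contra! hle
  obtain ⟨p, hp⟩ := hconn.exists_walk_length_eq_dist ⟨A, hA⟩ ⟨B, hB⟩
  rw [← hp] at hle
  have hadj : ∀ i < p.length, ExchangeAdj (p.getVert i).1 (p.getVert (i + 1)).1 :=
    fun i hi => exchangeAdj_of_adj (p.adj_getVert_succ hi)
  refine h ⟨p.length, fun i => (p.getVert i).1, by simp, by simp, fun i _ => (p.getVert i).2,
    hadj, fun i j k hij hjk hk x hxi hxk => ?_⟩
  exact convex_of_length_le (f := fun i => (p.getVert i).1) hAB (by simp) (by simp)
    (fun i _ x hx => hcov x (singleton_mem_faces (p.getVert i).2.1 hx)) hadj hle hij hjk hk hxi hxk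

theorem hasConvexSequence_of_isNonRevisiting {F G : {s : Finset V // K.IsFacet s}}
    {p : K.ridgeGraph.Walk F G} (hp : IsNonRevisiting p) : K.HasConvexSequence F.1 G.1 := by
  refine ⟨p.length, fun i => (p.getVert i).1, by simp, by simp, fun i _ => (p.getVert i).2,
    fun i hi => exchangeAdj_of_adj (p.adj_getVert_succ hi), fun i j k hij hjk hk x hxi hxk => ?_⟩
  refine Nat.decreasingInduction' (P := fun l => x ∈ (p.getVert l).1) (fun l hl hjl hxl => ?_)
    hjk hxk
  by_contra hx
  exact hp l (by omega) x hxl hx i (by omega) hxi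

end

end PreAbstractSimplicialComplex

/-! ### Finite sets as binary numbers, for computation -/

/-- The set of positions of the binary digits `1` of a natural number. -/
def bits (m : ℕ) : Finset ℕ := (Finset.range m).filter fun i => m.testBit i

theorem mem_bits {m i : ℕ} : i ∈ bits m ↔ m.testBit i = true := by
  unfold bits
  rw [Finset.mem_filter, Finset.mem_range, and_iff_right_iff_imp]
  exact fun h => Nat.lt_two_pow_self.trans_le (Nat.ge_two_pow_of_testBit h)

theorem bits_injective : Function.Injective bits := by
  intro a b h
  refine Nat.eq_of_testBit_eq fun i => ?_
  rw [Bool.eq_iff_iff, ← mem_bits, ← mem_bits, h]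

theorem bits_and (a b : ℕ) : bits (a &&& b) = bits a ∩ bits b := by
  ext i
  simp [mem_bits, Nat.testBit_and]

theorem bits_or (a b : ℕ) : bits (a ||| b) = bits a ∪ bits b := by
  ext i
  simp [mem_bits, Nat.testBit_or]

theorem bits_two_pow (i : ℕ) : bits (2 ^ i) = {i} := by
  ext j
  simp [mem_bits, Nat.testBit_two_pow, eq_comm]

theorem bits_and_xor (a b : ℕ) : bits (a &&& (a ^^^ b)) = bits a \ bits b := by
  ext i
  simp only [mem_bits, Nat.testBit_and, Nat.testBit_xor, Finset.mem_sdiff]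
  cases a.testBit i <;> cases b.testBit i <;> simp

theorem bits_xor_two_pow {a i : ℕ} (h : a.testBit i = true) :
    bits (a ^^^ 2 ^ i) = (bits a).erase i := by
  ext j
  simp only [mem_bits, Nat.testBit_xor, Nat.testBit_two_pow, Finset.mem_erase]
  by_cases hj : i = j
  · subst hj
    simp [h]
  · simp [hj, Ne.symm hj]

theorem bits_subset_iff {a b : ℕ} : bits a ⊆ bits b ↔ b &&& a = a := by
  rw [← bits_injective.eq_iff, bits_and, Finset.inter_eq_right]

theorem bits_nonempty_iff {a : ℕ} : (bits a).Nonempty ↔ a ≠ 0 := by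
  rw [Finset.nonempty_iff_ne_empty, Ne, Ne, ← bits_injective.eq_iff]
  rfl

/-- Test for a power of two. -/
def isPow (a : ℕ) : Bool := a == 2 ^ a.log2

theorem isPow_iff {a : ℕ} : isPow a = true ↔ (bits a).card = 1 := by
  rw [isPow, beq_iff_eq]
  constructor
  · intro h
    rw [h, bits_two_pow, Finset.card_singleton]
  · intro h
    obtain ⟨i, hi⟩ := Finset.card_eq_one.1 h
    have : a = 2 ^ i := bits_injective (hi.trans (bits_two_pow i).symm)
    rw [this, Nat.log2_two_pow]

/-- Test for two sets, given as binary numbers, to differ by the exchange of one element. -/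
def adjBits (a b : ℕ) : Bool := isPow (a &&& (a ^^^ b)) && isPow (b &&& (b ^^^ a))

theorem adjBits_iff {a b : ℕ} :
    adjBits a b = true ↔ (bits a \ bits b).card = 1 ∧ (bits b \ bits a).card = 1 := by
  rw [adjBits, Bool.and_eq_true, isPow_iff, isPow_iff, bits_and_xor, bits_and_xor]

/-- The positions below `16` of the binary digits `1`. -/
def bitList (a : ℕ) : List ℕ := (List.range 16).filter a.testBit

theorem mem_bitList {a i : ℕ} (ha : a < 2 ^ 16) : i ∈ bitList a ↔ i ∈ bits a := by
  rw [bitList, List.mem_filter, mem_bits, List.mem_range, and_iff_right_iff_imp]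
  intro h
  by_contra! hi
  rw [Nat.testBit_lt_two_pow (ha.trans_le (Nat.pow_le_pow_right (by norm_num) hi))] at h
  exact absurd h (by simp)

/-! ### Computable tests for flips, connectedness and non-revisiting paths -/

namespace PreAbstractSimplicialComplex

/-- The complex generated by a list of sets. -/
def ofBits (l : List ℕ) : PreAbstractSimplicialComplex ℕ where
  faces := {s | s.Nonempty ∧ ∃ F ∈ l, s ⊆ bits F}
  isRelLowerSet_faces := by
    rintro s ⟨hs, F, hF, hsF⟩
    exact ⟨hs, fun t hts ht => ⟨ht, F, hF, hts.trans hsF⟩⟩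

theorem mem_ofBits {l : List ℕ} {s : Finset ℕ} :
    s ∈ (ofBits l).faces ↔ s.Nonempty ∧ ∃ F ∈ l, s ⊆ bits F :=
  Iff.rfl

theorem ofBits_congr {l l' : List ℕ} (h : ∀ F, F ∈ l ↔ F ∈ l') : ofBits l = ofBits l' := by
  ext s
  simp [mem_ofBits, h]

theorem finite_ofBits (l : List ℕ) : (ofBits l).faces.Finite := by
  refine (Set.Finite.biUnion l.toFinset.finite_toSet
    fun F _ => (bits F).powerset.finite_toSet).subset ?_
  rintro s ⟨-, F, hF, hs⟩
  exact Set.mem_biUnion (x := F) (by simpa using hF) (by simpa using hs)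

theorem isFacet_ofBits_iff {l : List ℕ} (h0 : ∀ F ∈ l, F ≠ 0)
    (h : ∀ F ∈ l, ∀ G ∈ l, G &&& F = F → F = G) {s : Finset ℕ} :
    (ofBits l).IsFacet s ↔ ∃ F ∈ l, s = bits F := by
  constructor
  · rintro ⟨⟨hs, F, hF, hsF⟩, hmax⟩
    exact ⟨F, hF, hsF.antisymm (hmax ⟨bits_nonempty_iff.2 (h0 F hF), F, hF, subset_rfl⟩ hsF)⟩
  · rintro ⟨F, hF, rfl⟩
    refine ⟨⟨bits_nonempty_iff.2 (h0 F hF), F, hF, subset_rfl⟩, ?_⟩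
    rintro t ⟨-, G, hG, htG⟩ hFt
    rwa [h F hF G hG (bits_subset_iff.1 (hFt.trans htG))]

/-- The facets of the boundary of a simplex. -/
def simplexBoundary (T : ℕ) : List ℕ := (bitList T).map fun i => T ^^^ 2 ^ i

theorem coneEquiv_simplexBoundary {T n : ℕ} (hT : T < 2 ^ 16) (hn : 0 < n)
    (hc : (bitList T).length = n + 1) :
    ConeEquiv (ofBits (simplexBoundary T)).cone (Set.univ : Set (Fin n → ℝ)) := by
  have hbT : bits T = (bitList T).toFinset := by
    ext i
    rw [List.mem_toFinset, mem_bitList hT]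
  refine coneEquiv_of_simplex_boundary (T := bits T) hn ?_ fun s => ?_
  · have hnd : (bitList T).Nodup := List.Nodup.filter _ List.nodup_range
    rw [hbT, List.toFinset_card_of_nodup hnd, hc]
  · rw [mem_ofBits, Finset.ssubset_iff_exists_subset_erase, and_congr_right_iff]
    intro _
    simp only [simplexBoundary, List.mem_map, mem_bitList hT]
    constructor
    · rintro ⟨F, ⟨i, hi, rfl⟩, hs⟩
      exact ⟨i, hi, by rwa [← bits_xor_two_pow (mem_bits.1 hi)]⟩
    · rintro ⟨i, hi, hs⟩
      exact ⟨_, ⟨i, hi, rfl⟩, by rwa [bits_xor_two_pow (mem_bits.1 hi)]⟩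

/-- The facets after the bistellar flip that exchanges `σ` for `τ`. -/
def flipFacets (l : List ℕ) (σ τ : ℕ) : List ℕ :=
  l.filter (fun F => F &&& σ != σ) ++ (bitList σ).map fun i => τ ||| (σ ^^^ 2 ^ i)

/-- Test for the bistellar flip that exchanges `σ` for `τ` to be possible. -/
def canFlip (l : List ℕ) (σ τ : ℕ) : Bool :=
  σ != 0 && τ != 0 && σ &&& τ == 0 && decide (σ < 2 ^ 16) && decide (τ < 2 ^ 16) &&
  l.all (fun F => F &&& τ != τ && (F &&& σ != σ || (σ ||| τ) &&& F == F)) &&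
  (bitList τ).all fun i => l.contains (σ ||| (τ ^^^ 2 ^ i))

/-- The test says that `τ` is not a face and that the link of `σ` is the boundary of `τ`; the flip
replaces `σ * ∂τ` by `∂σ * τ`. -/
theorem coneEquiv_flipFacets {l : List ℕ} {σ τ : ℕ} (h : canFlip l σ τ = true) :
    ConeEquiv (ofBits l).cone (ofBits (flipFacets l σ τ)).cone := by
  simp only [canFlip, Bool.and_eq_true, bne_iff_ne, beq_iff_eq, decide_eq_true_eq, List.all_eq_true,
    Bool.or_eq_true, List.contains_iff_mem] at h
  obtain ⟨⟨⟨⟨⟨⟨hσ, hτ⟩, hd⟩, hσ'⟩, hτ'⟩, hl⟩, hnew⟩ := h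
  have hdis : Disjoint (bits σ) (bits τ) := by
    rw [Finset.disjoint_iff_inter_eq_empty, ← bits_and, hd]
    rfl
  have hmem : ∀ G, G ∈ flipFacets l σ τ ↔
      (G ∈ l ∧ ¬ bits σ ⊆ bits G) ∨ ∃ i ∈ bits σ, G = τ ||| (σ ^^^ 2 ^ i) := by
    intro G
    simp only [flipFacets, List.mem_append, List.mem_filter, bne_iff_ne, List.mem_map,
      mem_bitList hσ', bits_subset_iff, eq_comm (a := G)]
  have hbits : ∀ {ρ π i : ℕ}, i ∈ bits ρ → bits (π ||| (ρ ^^^ 2 ^ i)) = bits π ∪ (bits ρ).erase i :=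
    fun hi => by rw [bits_or, bits_xor_two_pow (mem_bits.1 hi)]
  have hsubKL : ∀ F ∈ l, bits σ ⊆ bits F → bits F ⊆ bits σ ∪ bits τ := by
    intro F hF hs
    rw [← bits_or, bits_subset_iff]
    exact (hl F hF).2.resolve_left (fun h => h (bits_subset_iff.1 hs))
  refine coneEquiv_of_flip (bits_nonempty_iff.2 hσ) (bits_nonempty_iff.2 hτ) hdis ?_ ?_ ?_ ?_
  · rintro s ⟨-, F, hF, hsF⟩ hs
    exact (hl F hF).1 (bits_subset_iff.1 (hs.trans hsF))
  · rintro s ⟨-, G, hG, hsG⟩ hs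
    rcases (hmem G).1 hG with h | ⟨i, hi, rfl⟩
    · exact h.2 (hs.trans hsG)
    · have := hsG (hs hi)
      rw [hbits hi, Finset.mem_union] at this
      rcases this with h | h
      · exact Finset.disjoint_left.1 hdis hi h
      · simp at h
  · rintro s ⟨hs, F, hF, hsF⟩
    by_cases hσF : bits σ ⊆ bits F
    · refine Or.inr fun a ha => ⟨((bits_nonempty_iff.2 hτ).mono Finset.subset_union_right),
        τ ||| (σ ^^^ 2 ^ a), (hmem _).2 (Or.inr ⟨a, ha, rfl⟩), fun x hx => ?_⟩
      rw [hbits ha, Finset.mem_union, Finset.mem_erase]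
      simp only [Finset.mem_union, Finset.mem_sdiff, Finset.mem_singleton] at hx
      rcases hx with hx | hx
      · rcases Finset.mem_union.1 (hsubKL F hF hσF (hsF hx.1)) with h | h
        exacts [Or.inr ⟨hx.2, h⟩, Or.inl h]
      · exact Or.inl hx
    · exact Or.inl ⟨hs, F, (hmem F).2 (Or.inl ⟨hF, hσF⟩), hsF⟩
  · rintro s ⟨hs, G, hG, hsG⟩
    rcases (hmem G).1 hG with h | ⟨i, hi, rfl⟩
    · exact Or.inl ⟨hs, G, h.1, hsG⟩
    · refine Or.inr fun a ha => ⟨((bits_nonempty_iff.2 hσ).mono Finset.subset_union_right),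
        σ ||| (τ ^^^ 2 ^ a), hnew a ((mem_bitList hτ').2 ha), fun x hx => ?_⟩
      rw [hbits ha, Finset.mem_union, Finset.mem_erase]
      simp only [Finset.mem_union, Finset.mem_sdiff, Finset.mem_singleton] at hx
      rcases hx with hx | hx
      · have := hsG hx.1
        rw [hbits hi, Finset.mem_union, Finset.mem_erase] at this
        rcases this with h | h
        exacts [Or.inr ⟨hx.2, h⟩, Or.inl h.2]
      · exact Or.inl hx

/-- Test for a sequence of bistellar flips to lead from one list of facets to another. -/
def flipsLead (target : List ℕ) : List ℕ → List (ℕ × ℕ) → Bool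
  | l, [] => l.all target.contains && target.all l.contains
  | l, (σ, τ) :: r => canFlip l σ τ && flipsLead target (flipFacets l σ τ) r

theorem coneEquiv_of_flipsLead {target : List ℕ} {l : List ℕ} {r : List (ℕ × ℕ)}
    (h : flipsLead target l r = true) : ConeEquiv (ofBits l).cone (ofBits target).cone := by
  induction r generalizing l with
  | nil =>
    simp only [flipsLead, Bool.and_eq_true, List.all_eq_true, List.contains_iff_mem] at h
    rw [ofBits_congr fun F => ⟨h.1 F, h.2 F⟩]
    exact ⟨id, id, continuousOn_id, continuousOn_id, Set.mapsTo_id _, Set.mapsTo_id _,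
      fun _ _ => rfl, fun _ _ => rfl, fun _ _ _ _ => rfl⟩
  | cons p r ih =>
    simp only [flipsLead, Bool.and_eq_true] at h
    exact (coneEquiv_flipFacets h.1).trans (ih h.2)

/-- Test for every set in the second list to be adjacent to one in the first list or before it in
the second. -/
def adjChain : List ℕ → List ℕ → Bool
  | _, [] => true
  | m, F :: r => m.any (adjBits F) && adjChain (F :: m) r

/-- Each facet in the list attaches to an earlier one, which yields by induction a path from it to
`A`. -/
theorem connected_of_adjChain {K : PreAbstractSimplicialComplex ℕ} {A : ℕ} {l : List ℕ}
    (hfacet : ∀ s, K.IsFacet s ↔ ∃ F ∈ A :: l, s = bits F) (h : adjChain [A] l = true) :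
    K.ridgeGraph.Connected := by
  have hA : K.IsFacet (bits A) := (hfacet _).2 ⟨A, by simp, rfl⟩
  have key : ∀ (r m : List ℕ), adjChain m r = true → (∀ F ∈ r, K.IsFacet (bits F)) →
      (∀ F ∈ m, ∃ hF : K.IsFacet (bits F), K.ridgeGraph.Reachable ⟨_, hA⟩ ⟨_, hF⟩) →
      ∀ F ∈ r, ∃ hF : K.IsFacet (bits F), K.ridgeGraph.Reachable ⟨_, hA⟩ ⟨_, hF⟩ := by
    intro r
    induction r with
    | nil => simp
    | cons F r ih =>
      intro m hm hr hreach
      simp only [adjChain, Bool.and_eq_true, List.any_eq_true] at hm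
      obtain ⟨⟨G, hG, hFG⟩, hm⟩ := hm
      obtain ⟨hG', hAG⟩ := hreach G hG
      have hF' : K.IsFacet (bits F) := hr F (by simp)
      have hF : ∃ hF : K.IsFacet (bits F), K.ridgeGraph.Reachable ⟨_, hA⟩ ⟨_, hF⟩ := by
        refine ⟨hF', hAG.trans (SimpleGraph.Adj.reachable ?_)⟩
        obtain ⟨h1, h2⟩ := adjBits_iff.1 hFG
        have h3 := Finset.card_sdiff_add_card_inter (bits F) (bits G)
        have h4 := Finset.card_sdiff_add_card_inter (bits G) (bits F)
        rw [Finset.inter_comm] at h3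
        exact ⟨by simp only; omega, by simp only; omega⟩
      have hrest := ih (F :: m) hm (fun E hE => hr E (by simp [hE])) (by
        intro E hE
        rcases List.mem_cons.1 hE with rfl | hE
        exacts [hF, hreach E hE])
      intro E hE
      rcases List.mem_cons.1 hE with rfl | hE
      exacts [hF, hrest E hE]
  have hall : ∀ S, K.ridgeGraph.Reachable ⟨_, hA⟩ S := by
    rintro ⟨s, hs⟩
    obtain ⟨F, hF, rfl⟩ := (hfacet s).1 hs
    rcases List.mem_cons.1 hF with rfl | hF
    · exact SimpleGraph.Reachable.refl _
    · exact (key l [A] h (fun F hF => (hfacet _).2 ⟨F, by simp [hF], rfl⟩) (by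
        intro E hE
        rw [List.mem_singleton] at hE
        subst hE
        exact ⟨hA, SimpleGraph.Reachable.refl _⟩) F hF).2
  have : Nonempty {s : Finset ℕ // K.IsFacet s} := ⟨⟨_, hA⟩⟩
  exact SimpleGraph.Connected.mk fun S T => (hall S).symm.trans (hall T)

/-- Search for a non-revisiting path to `B` that continues a path with the last facet `F` and the
set `U` of all vertices met so far; the answer `true` means that there is none. -/
def noPath (l : List ℕ) (B : ℕ) : ℕ → ℕ → ℕ → Bool
  | 0, _, _ => false
  | n + 1, F, U => F != B && (U &&& B != F &&& B ||
      l.all fun G => G &&& U != G &&& F || !adjBits F G || noPath l B n G (U ||| G))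

/-- The search prunes a facet that revisits a vertex, and a position where a vertex of `B` has
already been left, since it would have to return at the end. Both contradict convexity. Exhausted
fuel answers `false`, so `true` certifies a complete search. -/
theorem not_hasConvexSequence_of_noPath {K : PreAbstractSimplicialComplex ℕ} {l : List ℕ}
    (hfacet : ∀ s, K.IsFacet s ↔ ∃ F ∈ l, s = bits F) {A B n : ℕ} (h : noPath l B n A A = true) :
    ¬ K.HasConvexSequence (bits A) (bits B) := by
  rintro ⟨N, f, f0, fN, hf, hadj, hconv⟩
  -- Induction on the fuel `n` and, inside it, on the number `k` of remaining steps: a pause in the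
  -- sequence reduces `k` but uses no fuel.
  have key : ∀ n k i F U, i + k = N → f i = bits F → (∀ x, x ∈ bits U ↔ ∃ j ≤ i, x ∈ f j) →
      noPath l B n F U = true → False := by
    intro n
    induction n with
    | zero => simp [noPath]
    | succ n ihn =>
      intro k
      induction k with
      | zero =>
        intro i F U hi hF _ h
        have : F = B := by
          apply bits_injective
          rw [← hF, ← fN, ← hi, add_zero]
        simp [noPath, this] at h
      | succ k ihk =>
        intro i F U hi hF hU h
        have h' := h
        simp only [noPath, Bool.and_eq_true, bne_iff_ne, Bool.or_eq_true, List.all_eq_true,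
          Bool.not_eq_true'] at h'
        have hUB : U &&& B = F &&& B := by
          apply bits_injective
          rw [bits_and, bits_and, ← fN, ← hF]
          ext x
          rw [Finset.mem_inter, Finset.mem_inter, hU]
          constructor
          · rintro ⟨⟨j, hj, hx⟩, hxN⟩
            exact ⟨hconv j i N hj (by omega) le_rfl x hx hxN, hxN⟩
          · exact fun hx => ⟨⟨i, le_rfl, hx.1⟩, hx.2⟩
        have hall := h'.2.resolve_left fun h => h hUB
        obtain ⟨G, hG, hfG⟩ := (hfacet _).1 (hf (i + 1) (by omega))
        by_cases hFG : F = G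
        · subst hFG
          refine ihk (i + 1) F U (by omega) hfG (fun x => ?_) h
          rw [hU]
          constructor
          · rintro ⟨j, hj, hx⟩
            exact ⟨j, by omega, hx⟩
          · rintro ⟨j, hj, hx⟩
            rcases Nat.lt_or_ge i j with hij | hij
            · have : j = i + 1 := by omega
              subst this
              exact ⟨i, le_rfl, by rwa [hF, ← hfG]⟩
            · exact ⟨j, hij, hx⟩
        · have hex := hadj i (by omega)
          rw [hF, hfG] at hex
          have hadjFG : adjBits F G = true := by
            rw [adjBits_iff]
            have h1 := Finset.card_sdiff_comm hex.1
            have h2 : (bits F \ bits G).card ≠ 0 := by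
              intro h0
              rw [Finset.card_eq_zero, Finset.sdiff_eq_empty_iff_subset] at h0
              exact hFG (bits_injective (Finset.eq_of_subset_of_card_le h0 hex.1.ge))
            have h3 := hex.2
            omega
          have hGU : G &&& U = G &&& F := by
            apply bits_injective
            rw [bits_and, bits_and, ← hF, ← hfG]
            ext x
            rw [Finset.mem_inter, Finset.mem_inter, hU]
            constructor
            · rintro ⟨hxG, j, hj, hx⟩
              exact ⟨hxG, hconv j i (i + 1) hj (by omega) (by omega) x hx hxG⟩
            · exact fun hx => ⟨hx.1, i, le_rfl, hx.2⟩
          rcases hall G hG with (h1 | h1) | h1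
          · exact h1 hGU
          · rw [hadjFG] at h1
            exact absurd h1 (by simp)
          · refine ihn k (i + 1) G (U ||| G) (by omega) hfG (fun x => ?_) h1
            rw [bits_or, Finset.mem_union, hU, ← hfG]
            constructor
            · rintro (⟨j, hj, hx⟩ | hx)
              exacts [⟨j, by omega, hx⟩, ⟨i + 1, le_rfl, hx⟩]
            · rintro ⟨j, hj, hx⟩
              rcases Nat.lt_or_ge i j with hij | hij
              · have : j = i + 1 := by omega
                subst this
                exact Or.inr hx
              · exact Or.inl ⟨j, hij, hx⟩
  refine key n N 0 A A (by omega) f0 (fun x => ?_) h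
  rw [← f0]
  simp

/-! ### The explicit 3-sphere and its certificates -/

/-- The facets of a triangulated `3`-sphere with the vertices `0, …, 15`. -/
def sphereFacets : List ℕ :=
  [15, 2059, 263, 1037, 526, 3081, 2186, 2307, 277, 774, 1093, 1548, 554, 3208, 19457, 34946,
   1162, 2321, 35074, 2069, 4372, 4868, 802, 17473, 581, 1604, 9736, 8744, 298, 19584, 18437,
   49282, 34948, 9226, 17538, 35088, 33034, 34836, 4376, 36884, 4613, 4896, 17474, 24641, 8769,
   9792, 12328, 8737, 4392, 18564, 16517, 49218, 49281, 36996, 8266, 9282, 33048, 32794, 12312,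
   36882, 4133, 4641, 24648, 24609, 12324, 165, 49248, 36930, 49185, 32929, 37056, 12420, 90,
   12432, 24600, 4178, 16472, 24624, 8356, 16496, 32992, 4304, 8368, 240]

/-- Bistellar flips leading from the boundary of a simplex to `sphereFacets`. -/
def sphereFlips : List (ℕ × ℕ) :=
  [(32962, 16), (210, 1), (194, 16385), (83, 32), (81, 160), (177, 4096), (4145, 256), (49,
   258), (4241, 4), (147, 2048), (145, 2052), (99, 8), (98, 24), (193, 16416), (4113, 260),
   (105, 8192), (104, 8208), (97, 24576), (2179, 1024), (131, 17408), (50, 264), (146, 34816),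
   (4385, 512), (289, 514), (2192, 32772), (35, 520), (8288, 16400), (148, 36864), (4353, 516),
   (16387, 1088), (304, 4104), (41, 8704), (56, 12288), (769, 6), (67, 1032), (515, 12), (8272,
   16392), (16576, 32800), (8201, 576), (1027, 2056), (4225, 36), (73, 1536), (32912, 4160),
   (521, 1028), (1537, 68), (19, 2304), (4144, 8320), (3074, 136), (584, 9216), (2066, 33024),
   (1153, 18432), (32848, 4098), (4256, 8196), (16544, 32769), (2177, 16388), (274, 32776),
   (1096, 8194)]

/-- The number 49346 encodes {1, 6, 7, 14, 15}, so the flips start at the boundary of a 4-simplex.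
-/
theorem flipsLead_sphereFacets :
    flipsLead sphereFacets (simplexBoundary 49346) sphereFlips = true := by
  decide +kernel

/-- Fuel 13 is enough: every move enters a vertex not met before, and only 12 of the 16 vertices lie
outside the first facet. -/
theorem noPath_sphereFacets : noPath sphereFacets 240 13 15 15 = true := by
  decide +kernel

theorem adjChain_sphereFacets : adjChain [15] sphereFacets.tail = true := by
  decide +kernel

theorem sphereFacets_maximal : ∀ F ∈ sphereFacets, ∀ G ∈ sphereFacets, G &&& F = F → F = G := by
  decide +kernel

end PreAbstractSimplicialComplex

/-! ### The eight wedgings -/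

namespace PreAbstractSimplicialComplex

theorem isFacet_sphereFacets_iff {s : Finset ℕ} :
    (ofBits sphereFacets).IsFacet s ↔ ∃ F ∈ sphereFacets, s = bits F :=
  isFacet_ofBits_iff (by decide +kernel) sphereFacets_maximal

theorem vertexSet_sphereFacets : (ofBits sphereFacets).vertexSet = {x | x < 16} := by
  ext x
  change ({x} : Finset ℕ).Nonempty ∧ (∃ F ∈ sphereFacets, {x} ⊆ bits F) ↔ x < 16
  simp only [Finset.singleton_nonempty, true_and, Finset.singleton_subset_iff, mem_bits]
  constructor
  · rintro ⟨F, hF, hx⟩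
    have h16 : ∀ F ∈ sphereFacets, F < 2 ^ 16 := by decide +kernel
    by_contra! hx'
    rw [Nat.testBit_lt_two_pow ((h16 F hF).trans_le (Nat.pow_le_pow_right (by norm_num) hx'))] at hx
    exact absurd hx (by simp)
  · have hall : ∀ x < 16, ∃ F ∈ sphereFacets, F.testBit x = true := by decide +kernel
    exact hall x

/-- The sphere given by `sphereFacets`, wedged successively at the vertices `8, 9, …`, with the new
vertices `16, 17, …`. -/
def wedgedSphere : ℕ → PreAbstractSimplicialComplex ℕ
  | 0 => ofBits sphereFacets
  | i + 1 => (wedgedSphere i).onePointSuspension (8 + i) (16 + i)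

/-- The facet `{0, 1, 2, 3}` with the wedged vertices added. -/
def oldFacet (i : ℕ) : Finset ℕ := Finset.range 4 ∪ Finset.Ico 8 (8 + i)

/-- The facet `{4, 5, 6, 7}` with the new vertices added. -/
def newFacet (i : ℕ) : Finset ℕ := Finset.Ico 4 8 ∪ Finset.Ico 16 (16 + i)

theorem mem_oldFacet {i x : ℕ} : x ∈ oldFacet i ↔ x < 4 ∨ 8 ≤ x ∧ x < 8 + i := by
  simp [oldFacet]

theorem mem_newFacet {i x : ℕ} : x ∈ newFacet i ↔ 4 ≤ x ∧ x < 8 ∨ 16 ≤ x ∧ x < 16 + i := by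
  simp [newFacet]

theorem bits_fifteen : bits 15 = oldFacet 0 := by decide

theorem bits_two_hundred_forty : bits 240 = newFacet 0 := by decide +kernel

theorem vertexSet_wedgedSphere {i : ℕ} (hi : i ≤ 8) :
    (wedgedSphere i).vertexSet = {x | x < 16 + i} := by
  induction i with
  | zero => exact vertexSet_sphereFacets
  | succ i ih =>
    have ih' := ih (by omega)
    rw [wedgedSphere, vertexSet_onePointSuspension (by rw [ih']; simp), ih']
    ext x
    simp only [Set.mem_insert_iff, Set.mem_ofPred_eq]
    omega

theorem ncard_vertexSet_wedgedSphere {i : ℕ} (hi : i ≤ 8) :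
    (wedgedSphere i).vertexSet.ncard = 16 + i := by
  have : {x | x < 16 + i} = (Finset.range (16 + i) : Set ℕ) := by
    ext x
    simp
  rw [vertexSet_wedgedSphere hi, this, Set.ncard_coe_finset, Finset.card_range]

theorem old_mem_vertexSet {i : ℕ} (hi : i < 8) : 8 + i ∈ (wedgedSphere i).vertexSet := by
  rw [vertexSet_wedgedSphere hi.le]
  simp only [Set.mem_ofPred_eq]
  omega

theorem new_notMem_vertexSet {i : ℕ} (hi : i < 8) : 16 + i ∉ (wedgedSphere i).vertexSet := by
  rw [vertexSet_wedgedSphere hi.le]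
  simp

theorem finite_wedgedSphere (i : ℕ) : (wedgedSphere i).faces.Finite := by
  induction i with
  | zero => exact finite_ofBits _
  | succ i ih => exact finite_onePointSuspension ih

/-- The certified flips, read backwards, handle the 3-sphere; every wedging then adds one dimension.
-/
theorem coneEquiv_wedgedSphere {i : ℕ} (hi : i ≤ 8) :
    ConeEquiv (wedgedSphere i).cone (Set.univ : Set (Fin (4 + i) → ℝ)) := by
  induction i with
  | zero =>
    refine ((coneEquiv_of_flipsLead flipsLead_sphereFacets).symm fun c hc x => smul_mem_cone hc).trans
      (coneEquiv_simplexBoundary (by norm_num) (by norm_num) (by decide +kernel))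
  | succ i ih =>
    exact coneEquiv_onePointSuspension (old_mem_vertexSet hi) (new_notMem_vertexSet hi)
      (ih (by omega))

theorem isTriangulatedSphere_wedgedSphere {i : ℕ} (hi : i ≤ 8) :
    (wedgedSphere i).IsTriangulatedSphere (3 + i) := by
  have h := coneEquiv_wedgedSphere hi
  rw [show 4 + i = 3 + i + 1 by omega] at h
  exact isTriangulatedSphere_of_coneEquiv (finite_wedgedSphere i) h

theorem connected_wedgedSphere {i : ℕ} (hi : i ≤ 8) : (wedgedSphere i).ridgeGraph.Connected := by
  induction i with
  | zero => exact connected_of_adjChain (fun _ => isFacet_sphereFacets_iff) adjChain_sphereFacets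
  | succ i ih =>
    exact connected_onePointSuspension (old_mem_vertexSet hi) (new_notMem_vertexSet hi)
      (ih (by omega))

theorem oldFacet_succ (i : ℕ) : oldFacet (i + 1) = insert (8 + i) (oldFacet i) := by
  ext x
  rw [Finset.mem_insert, mem_oldFacet, mem_oldFacet]
  omega

theorem newFacet_succ (i : ℕ) : newFacet (i + 1) = insert (16 + i) (newFacet i) := by
  ext x
  rw [Finset.mem_insert, mem_newFacet, mem_newFacet]
  omega

theorem isFacet_oldFacet {i : ℕ} (hi : i ≤ 8) : (wedgedSphere i).IsFacet (oldFacet i) := by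
  induction i with
  | zero => exact isFacet_sphereFacets_iff.2 ⟨15, by decide +kernel, bits_fifteen.symm⟩
  | succ i ih =>
    rw [oldFacet_succ]
    refine isFacet_insert_old (old_mem_vertexSet hi) (new_notMem_vertexSet hi) (ih (by omega)) ?_
    rw [mem_oldFacet]
    omega

theorem isFacet_newFacet {i : ℕ} (hi : i ≤ 8) : (wedgedSphere i).IsFacet (newFacet i) := by
  induction i with
  | zero => exact isFacet_sphereFacets_iff.2 ⟨240, by decide +kernel, bits_two_hundred_forty.symm⟩
  | succ i ih =>
    rw [newFacet_succ]
    exact isFacet_insert_new (old_mem_vertexSet hi) (new_notMem_vertexSet hi) (ih (by omega))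

/-- A convex sequence upstairs would collapse to one downstairs; the wedged vertex and the new one
lie in neither of the two smaller facets. -/
theorem not_hasConvexSequence_wedgedSphere {i : ℕ} (hi : i ≤ 8) :
    ¬ (wedgedSphere i).HasConvexSequence (oldFacet i) (newFacet i) := by
  induction i with
  | zero =>
    rw [← bits_fifteen, ← bits_two_hundred_forty]
    exact not_hasConvexSequence_of_noPath (fun _ => isFacet_sphereFacets_iff) noPath_sphereFacets
  | succ i ih =>
    intro h
    rw [oldFacet_succ, newFacet_succ] at h
    refine ih (by omega) (h.of_onePointSuspension (old_mem_vertexSet hi) (new_notMem_vertexSet hi)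
      ?_ ?_ ?_ ?_)
    all_goals
      simp only [mem_oldFacet, mem_newFacet]
      omega

theorem not_hasNonRevisitingProperty_wedgedSphere :
    ¬ (wedgedSphere 0).HasNonRevisitingProperty := by
  intro h
  obtain ⟨p, hp⟩ := h ⟨_, isFacet_oldFacet (Nat.zero_le 8)⟩ ⟨_, isFacet_newFacet (Nat.zero_le 8)⟩
  exact not_hasConvexSequence_wedgedSphere (Nat.zero_le 8) (hasConvexSequence_of_isNonRevisiting hp)

theorem lt_diam_wedgedSphere : 12 < (wedgedSphere 8).ridgeGraph.diam := by
  -- The bound 12 is the size 4 + 8 of `oldFacet 8`, which together with `newFacet 8` partitions the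
  -- 24 vertices.
  refine lt_diam_of_not_hasConvexSequence (finite_wedgedSphere 8) (connected_wedgedSphere le_rfl)
    (isFacet_oldFacet le_rfl) (isFacet_newFacet le_rfl) ?_ ?_
    (not_hasConvexSequence_wedgedSphere le_rfl)
  · rw [Finset.disjoint_left]
    intro x
    rw [mem_oldFacet, mem_newFacet]
    omega
  · intro x hx
    rw [vertexSet_wedgedSphere le_rfl, Set.mem_ofPred_eq] at hx
    rw [Finset.mem_union, mem_oldFacet, mem_newFacet]
    omega

end PreAbstractSimplicialComplex


/-- There is a triangulated `3`-sphere `L 0` with `16` vertices and without the non-revisiting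
property, from which eight successive wedgings lead to a triangulated `11`-sphere `L 8` with `24`
vertices and ridge-graph diameter at least `13`; the topological Hirsch conjecture is false.
The diameter is `SimpleGraph.diam`, which is `0` for a disconnected graph, so that the lower bound
also says that the ridge-graph is connected. -/
theorem theorem3p12 :
    (∃ L : ℕ → PreAbstractSimplicialComplex ℕ,
      ((L 0).IsTriangulatedSphere 3 ∧ (L 0).vertexSet.ncard = 16 ∧
        ¬ (L 0).HasNonRevisitingProperty) ∧
      (∀ i < 8, (L (i + 1)).IsWedgeOf (L i)) ∧
      ((L 8).IsTriangulatedSphere 11 ∧ (L 8).vertexSet.ncard = 24 ∧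
        13 ≤ (L 8).ridgeGraph.diam)) ∧
    ¬ TopologicalHirschConjecture := by
  have hsphere := PreAbstractSimplicialComplex.isTriangulatedSphere_wedgedSphere (le_refl 8)
  have hcard := PreAbstractSimplicialComplex.ncard_vertexSet_wedgedSphere (le_refl 8)
  have hdiam := PreAbstractSimplicialComplex.lt_diam_wedgedSphere
  refine ⟨⟨PreAbstractSimplicialComplex.wedgedSphere,
    ⟨PreAbstractSimplicialComplex.isTriangulatedSphere_wedgedSphere (Nat.zero_le 8),
      PreAbstractSimplicialComplex.ncard_vertexSet_wedgedSphere (Nat.zero_le 8),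
      PreAbstractSimplicialComplex.not_hasNonRevisitingProperty_wedgedSphere⟩,
    fun i hi => ⟨_, PreAbstractSimplicialComplex.old_mem_vertexSet hi, _,
      PreAbstractSimplicialComplex.new_notMem_vertexSet hi, rfl⟩, hsphere, hcard, hdiam⟩, ?_⟩
  intro h
  -- With `e = 11` the conjecture would give diameter + 12 ≤ 24.
  have := h ℕ (PreAbstractSimplicialComplex.wedgedSphere 8) 11 hsphere
  omega
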